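/- Let $\mathcal A$ be a Hopf $*$-algebra over $\mathbb C$ (with comultiplication $\Delta$ a $*$-homomorphism) that admits a positive Haar integral $h$, i.e. a unital linear functional with $(\mathrm{id}\otimes h)\Delta(a)=(h\otimes \mathrm{id})\Delta(a)=h(a)1$ and $h(a^*a)\ge 0$ for all $a\in\mathcal A$ (for instance, the Hopf $*$-algebra of a compact quantum group). A $*$-differential calculus over $\mathcal A$ is a graded $*$-differential algebra $(\Omega,d)$, $\Omega=\bigoplus_{k\ge0}\Omega_k$ (so $d$ has degree $1$, $d^2=0$, $d(\omega^*)=(d\omega)^*$, $d(\omega'\omega)=d(\omega')\omega+(-1)^k\omega'd\omega$ for $\omega'\in\Omega_k$, and $(\omega\eta)^*=(-1)^{kl}\eta^*\omega^*$ for $\omega\in\Omega_k$, $\eta\in\Omega_l$), such that: $\Omega_0=\mathcal A$ as $*$-algebras and, for $k>0$, $\Omega_k$ is the linear span of the forms $a_0\,da_1\cdots da_k$ with $a_i\in\mathcal A$; there is an algebra homomorphism $\Delta_\Omega\colon\Omega\to\mathcal A\otimes\Omega$ extending $\Delta$ with $(\mathrm{id}\otimes d)\Delta_\Omega=\Delta_\Omega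 d$; and $d1=0$. Put $\Omega^{\mathrm{inv}}=\{\omega\in\Omega:\Delta_\Omega(\omega)=1\otimes\omega\}$ and $\Omega^{\mathrm{inv}}_k=\Omega_k\cap\Omega^{\mathrm{inv}}$. Let $(\Omega,d)$ be such a calculus, and suppose that $\Omega^{\mathrm{inv}}$ is finite dimensional; that $\Omega$ has dimension $N$, i.e. $\Omega_N\ne0$ and $\Omega_k=0$ for $k>N$; that $\dim\Omega^{\mathrm{inv}}_N=1$; that $d(\Omega^{\mathrm{inv}}_{N-1})=0$ (no condition if $N=0$); and that $\Omega$ is non-degenerate, i.e. if $0\le k\le N$, $\omega\in\Omega_k$ and $\omega'\omega=0$ for all $\omega'\in\Omega_{N-k}$, then $\omega=0$. Let $\theta\in\Omega^{\mathrm{inv}}_N$ be a volume element, i.e. $\theta\neq0$ and $\theta^*=\theta$. Then there is a unique linear functional $\int$ on $\Omega$ with $\int\omega=0$ for $\omega\in\Omega_k$, $k<N$, and $\int a\theta=h(a)$ for $a\in\mathcal A$. There is a unique algebra automorphism $\sigma$ of $\Omega$ of degree zero (the twist automorphism) such that $\sigma d=d\sigma$ and $\int\omega'\omega=(-1)^{kl}\int\sigma(\omega)\omega'$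 for all $k,l\ge0$, $\omega'\in\Omega_k$, $\omega\in\Omega_l$; in particular $\sigma(\mathcal A)\subseteq\mathcal A$. Finally, the following are equivalent: 1. There exists an inner product $\langle\cdot,\cdot\rangle$ on $\Omega$ (linear in the first variable) that is graded (the spaces $\Omega_k$ are pairwise orthogonal) and left-invariant ($\langle a\omega,b\eta\rangle=h(b^*a)\langle\omega,\eta\rangle$ for all $a,b\in\mathcal A$ and $\omega,\eta\in\Omega^{\mathrm{inv}}$), such that $\langle\sigma(\omega),\omega\rangle\ge0$ for all $\omega\in\Omega$. 2. $h(a^*\sigma(a))\ge0$ for all $a\in\mathcal A$. -/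

import Mathlib

open scoped TensorProduct ComplexConjugate ComplexOrder

/-- A Hopf `*`-algebra over `ℂ`: a Hopf algebra which is a `*`-algebra (with conjugate-linear
involution) such that the comultiplication is a `*`-homomorphism. -/
class IsHopfStarAlgebra (A : Type*) [Ring A] [StarRing A] [HopfAlgebra ℂ A]
    [StarModule ℂ A] : Prop where
  comul_star : ∀ a : A,
    (Coalgebra.comul (R := ℂ) (star a) : A ⊗[ℂ] A) = star (Coalgebra.comul (R := ℂ) a)

/-- A positive Haar integral on a Hopf `*`-algebra: a unital linear functional `h` with
`(id ⊗ h)Δ(a) = (h ⊗ id)Δ(a) = h(a)1` and `h(a* a) ≥ 0` for all `a`. -/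
structure IsPositiveHaarIntegral {A : Type*} [Ring A] [StarRing A] [HopfAlgebra ℂ A]
    (h : A →ₗ[ℂ] ℂ) : Prop where
  map_one : h 1 = 1
  id_tensor : ∀ a : A,
    TensorProduct.rid ℂ A (h.lTensor A (Coalgebra.comul (R := ℂ) a)) = h a • (1 : A)
  tensor_id : ∀ a : A,
    TensorProduct.lid ℂ A (h.rTensor A (Coalgebra.comul (R := ℂ) a)) = h a • (1 : A)
  nonneg : ∀ a : A, 0 ≤ h (star a * a)

/-- A graded `*`-algebra structure on `Ω`: a positive algebra grading and a graded involution. -/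
structure GradedStarAlgebra (Ω : Type*) [Ring Ω] [Algebra ℂ Ω] where
  /-- the space of `k`-forms -/
  form : ℕ → Submodule ℂ Ω
  isInternal : DirectSum.IsInternal form
  mul_mem : ∀ {k l : ℕ} {ω η : Ω}, ω ∈ form k → η ∈ form l → ω * η ∈ form (k + l)
  /-- the graded involution `ω ↦ ω*` -/
  invol : Ω →ₗ⋆[ℂ] Ω
  invol_mem : ∀ {k : ℕ} {ω : Ω}, ω ∈ form k → invol ω ∈ form k
  invol_invol : ∀ ω : Ω, invol (invol ω) = ω
  invol_mul : ∀ {k l : ℕ} {ω η : Ω}, ω ∈ form k → η ∈ form l →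
    invol (ω * η) = (-1 : ℂ) ^ (k * l) • (invol η * invol ω)

/-- A graded `*`-differential algebra structure on `Ω`. -/
structure GradedStarDifferentialAlgebra (Ω : Type*) [Ring Ω] [Algebra ℂ Ω]
    extends GradedStarAlgebra Ω where
  /-- the differential -/
  d : Ω →ₗ[ℂ] Ω
  d_mem : ∀ {k : ℕ} {ω : Ω}, ω ∈ form k → d ω ∈ form (k + 1)
  d_d : ∀ ω : Ω, d (d ω) = 0
  d_invol : ∀ ω : Ω, d (invol ω) = invol (d ω)
  d_mul : ∀ {k : ℕ} {ω' : Ω}, ω' ∈ form k → ∀ ω : Ω,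
    d (ω' * ω) = d ω' * ω + (-1 : ℂ) ^ k • (ω' * d ω)

/-- A (left-covariant) `*`-differential calculus over the Hopf `*`-algebra `A`. The equality
`Ω₀ = A` of `*`-algebras is expressed by an injective `*`-preserving homomorphism `incl` of `A`
onto `Ω₀`; the left coaction `coact` is uniquely determined by the other data. -/
structure StarDifferentialCalculus (A Ω : Type*) [Ring A] [StarRing A] [HopfAlgebra ℂ A]
    [Ring Ω] [Algebra ℂ Ω] extends GradedStarDifferentialAlgebra Ω where
  /-- the identification of `A` with the algebra of `0`-forms -/
  incl : A →ₐ[ℂ] Ω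
  incl_injective : Function.Injective incl
  range_incl : LinearMap.range incl.toLinearMap = form 0
  incl_star : ∀ a : A, incl (star a) = invol (incl a)
  form_eq_span : ∀ k : ℕ, 0 < k → form k =
    Submodule.span ℂ {ω : Ω | ∃ (a₀ : A) (a : Fin k → A),
      ω = incl a₀ * (List.ofFn fun i => d (incl (a i))).prod}
  /-- the left coaction `Δ_Ω` -/
  coact : Ω →ₐ[ℂ] A ⊗[ℂ] Ω
  coact_incl : ∀ a : A,
    coact (incl a) = incl.toLinearMap.lTensor A (Coalgebra.comul (R := ℂ) a)
  coact_d : ∀ ω : Ω, coact (d ω) = d.lTensor A (coact ω)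
  d_one : d 1 = 0

namespace StarDifferentialCalculus

variable {A Ω : Type*} [Ring A] [StarRing A] [HopfAlgebra ℂ A] [Ring Ω] [Algebra ℂ Ω]
  (C : StarDifferentialCalculus A Ω)

/-- The space of left-invariant forms. -/
def inv : Submodule ℂ Ω where
  carrier := {ω | C.coact ω = 1 ⊗ₜ[ℂ] ω}
  add_mem' := by
    intro x y hx hy
    change C.coact (x + y) = 1 ⊗ₜ[ℂ] (x + y)
    change C.coact x = _ at hx
    change C.coact y = _ at hy
    rw [map_add, hx, hy, TensorProduct.tmul_add]
  zero_mem' := by simp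
  smul_mem' := by
    intro c x hx
    change C.coact (c • x) = 1 ⊗ₜ[ℂ] (c • x)
    change C.coact x = _ at hx
    rw [map_smul, hx, TensorProduct.tmul_smul]

/-- The space of left-invariant `k`-forms. -/
def invForm (k : ℕ) : Submodule ℂ Ω := C.form k ⊓ C.inv

/-- Strong finite-dimensionality: the space of left-invariant forms is finite dimensional. -/
def StronglyFiniteDimensional : Prop := FiniteDimensional ℂ C.inv

/-- The calculus has dimension `N`: there are nonzero `N`-forms, and no nonzero `k`-forms
for `k > N`. -/
def HasDimension (N : ℕ) : Prop := C.form N ≠ ⊥ ∧ ∀ k, N < k → C.form k = ⊥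

/-- Non-degeneracy of a calculus of dimension `N`. -/
def Nondegenerate (N : ℕ) : Prop :=
  ∀ k, k ≤ N → ∀ ω ∈ C.form k, (∀ ω' ∈ C.form (N - k), ω' * ω = 0) → ω = 0

/-- A volume element: a nonzero self-adjoint left-invariant `N`-form. (When the left-invariant
`N`-forms are one-dimensional, each such form has norm one for a suitable choice of inner product,
and a unit vector among them is unique up to sign.) -/
structure IsVolumeElement (N : ℕ) (θ : Ω) : Prop where
  mem : θ ∈ C.invForm N
  ne_zero : θ ≠ 0
  selfAdjoint : C.invol θ = θ

/-- `I` is the integral `∫` associated to `θ`: it vanishes on `k`-forms with `k < N`, and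
`∫ aθ = h(a)`. -/
structure IsIntegral (h : A →ₗ[ℂ] ℂ) (N : ℕ) (θ : Ω) (I : Ω →ₗ[ℂ] ℂ) : Prop where
  of_lt : ∀ k, k < N → ∀ ω ∈ C.form k, I ω = 0
  top : ∀ a : A, I (C.incl a * θ) = h a

/-- `σ` is the twist automorphism of the functional `I`: an algebra automorphism of degree zero
commuting with `d` such that `∫ ω'ω = (-1)^{kl} ∫ σ(ω)ω'` for `ω'` a `k`-form, `ω` an `l`-form. -/
structure IsTwistAutomorphism (I : Ω →ₗ[ℂ] ℂ) (σ : Ω ≃ₐ[ℂ] Ω) : Prop where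
  map_mem : ∀ {k : ℕ} {ω : Ω}, ω ∈ C.form k → σ ω ∈ C.form k
  map_d : ∀ ω : Ω, σ (C.d ω) = C.d (σ ω)
  twisted : ∀ {k l : ℕ} {ω' ω : Ω}, ω' ∈ C.form k → ω ∈ C.form l →
    I (ω' * ω) = (-1 : ℂ) ^ (k * l) * I (σ ω * ω')

theorem incl_mem (a : A) : C.incl a ∈ C.form 0 := by
  rw [← C.range_incl]
  exact ⟨a, rfl⟩

variable {C} in
/-- The restriction `σ_A` of the twist automorphism to `A = Ω₀`. -/
noncomputable def IsTwistAutomorphism.restrict {I : Ω →ₗ[ℂ] ℂ} {σ : Ω ≃ₐ[ℂ] Ω}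
    (hσ : C.IsTwistAutomorphism I σ) : A →ₐ[ℂ] A :=
  ((AlgEquiv.ofInjective C.incl C.incl_injective).symm : C.incl.range →ₐ[ℂ] A).comp
    (((σ : Ω →ₐ[ℂ] Ω).comp C.incl).codRestrict C.incl.range (by
      intro a
      have h1 : σ (C.incl a) ∈ C.form 0 := hσ.map_mem (C.incl_mem a)
      rw [← C.range_incl] at h1
      exact h1))

variable {C} in
theorem IsTwistAutomorphism.incl_restrict {I : Ω →ₗ[ℂ] ℂ} {σ : Ω ≃ₐ[ℂ] Ω}
    (hσ : C.IsTwistAutomorphism I σ) (a : A) : C.incl (hσ.restrict a) = σ (C.incl a) := by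
  exact congrArg Subtype.val
    ((AlgEquiv.ofInjective C.incl C.incl_injective).apply_symm_apply _)

/-- An inner product is graded if the spaces of `k`-forms are pairwise orthogonal. -/
def IsGradedInner (ip : InnerProductSpace.Core ℂ Ω) : Prop :=
  ∀ j k, j ≠ k → ∀ ω ∈ C.form j, ∀ η ∈ C.form k, ip.inner ω η = 0

/-- Left-invariance of an inner product on `Ω`. Mathlib's inner products are linear in the second
variable, so `ip.inner ω η` is `⟨η, ω⟩` for the convention of linearity in the first variable,
and the condition reads `⟨aω, bη⟩ = h(b* a)⟨ω, η⟩` in the latter. -/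
def IsLeftInvariantInner (h : A →ₗ[ℂ] ℂ) (ip : InnerProductSpace.Core ℂ Ω) : Prop :=
  ∀ a b : A, ∀ ω ∈ C.inv, ∀ η ∈ C.inv,
    ip.inner (C.incl b * η) (C.incl a * ω) = h (star b * a) * ip.inner η ω

end StarDifferentialCalculus

/-!
The integral exists and is unique because `Ω` is a free left `A`-module on the invariant forms
(`toTensor_incl_mul`, `mem_of_incl_mul_invForm_mem`), so that `Ω_N = Aθ`. It is invariant for the
coaction, hence closed (`IsIntegral.map_d`), and it inherits nondegeneracy on both sides from `Ω`
and from the faithfulness of `h` (`IsPositiveHaarIntegral.eq_zero_of_forall_mul_left`).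

For the twist automorphism, consider the pairs `(ω, η)` with `∫ ω'ω = ∫ ηω'` for all `ω'`. By
nondegeneracy they form the graph of an injective map, and both projections of this graph are
subalgebras of `Ω`. They contain `A`: the Haar integral has a modular automorphism
(`IsPositiveHaarIntegral.mul_eq_modularMap_mul`), given by an explicit formula in terms of the
antipode, and `θA = Aθ`. They contain `dA`, by integration by parts. Since `A` and `dA` generate
`Ω`, the graph is that of an automorphism, and correcting it by a sign in each degree gives `σ`.

Given an inner product as in the first condition, the second follows on restricting to the forms
`a1`. For the converse, every element of `A` lies in a finite-dimensional `*`-invariant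
subcoalgebra. The antipode, and hence the modular automorphism and `σ`, preserve such a
subcoalgebra (`IsPositiveHaarIntegral.antipode_mem`, `IsTwistAutomorphism.restrict_mem`). If
`σ` is positive on `A`, then `A` is therefore spanned by eigenvectors of `σ` with nonnegative
eigenvalues, and so is `Ω`, because `σ` is multiplicative and commutes with `d`. By strong left
invariance of the integral `σ` preserves the finite-dimensional spaces of invariant `k`-forms
(`IsTwistAutomorphism.map_mem_inv`), which thus have bases `vᵢ` of eigenvectors with
eigenvalues `λᵢ ≥ 0`. For the left-invariant inner product that makes these bases orthonormal,
`ω = ∑ aᵢvᵢ` satisfies `⟨σ(ω), ω⟩ = ∑ λᵢ h(aᵢ* σ(aᵢ)) ≥ 0`.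
-/

/-! ### Convolution along a coaction -/

section Convolution

variable {A B X Y : Type*} [Ring A] [HopfAlgebra ℂ A] [AddCommGroup B] [Module ℂ B]
  [Ring X] [Algebra ℂ X] [Ring Y] [Algebra ℂ Y]

/-- The convolution `x ↦ f(x₁) t(x₂)` of a linear map `f` on `A` with a linear map `t` on `B`,
along `δ(x) = x₁ ⊗ x₂ ∈ A ⊗ B`. For `δ` the comultiplication it is the usual convolution. -/
noncomputable def convAlong (δ : B →ₗ[ℂ] A ⊗[ℂ] B) (f : A →ₗ[ℂ] X) (t : B →ₗ[ℂ] X) :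
    B →ₗ[ℂ] X :=
  LinearMap.mul' ℂ X ∘ₗ TensorProduct.map f t ∘ₗ δ

/-- `δ` is a left coaction of the coalgebra `A` on `B`. -/
structure IsLeftCoaction (δ : B →ₗ[ℂ] A ⊗[ℂ] B) : Prop where
  coassoc : ∀ x, TensorProduct.assoc ℂ A A B
    ((Coalgebra.comul (R := ℂ) (A := A)).rTensor B (δ x)) = δ.lTensor A (δ x)
  counit : ∀ x, (Coalgebra.counit (R := ℂ) (A := A)).rTensor B (δ x) = 1 ⊗ₜ x

theorem isLeftCoaction_comul :
    IsLeftCoaction (Coalgebra.comul (R := ℂ) : A →ₗ[ℂ] A ⊗[ℂ] A) :=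
  ⟨Coalgebra.coassoc_apply, Coalgebra.rTensor_counit_comul⟩

variable {δ : B →ₗ[ℂ] A ⊗[ℂ] B}

theorem convAlong_convAlong (hδ : IsLeftCoaction δ) (f g : A →ₗ[ℂ] X) (t : B →ₗ[ℂ] X) :
    convAlong δ f (convAlong δ g t) =
      convAlong δ (convAlong (Coalgebra.comul (R := ℂ)) f g) t := by
  ext x
  have h1 : ∀ u : A ⊗[ℂ] B, LinearMap.mul' ℂ X (TensorProduct.map f (convAlong δ g t) u) =
      LinearMap.mul' ℂ X (TensorProduct.map f (LinearMap.mul' ℂ X ∘ₗ TensorProduct.map g t)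
        (δ.lTensor A u)) := by
    intro u
    induction u with
    | zero => simp
    | add u v hu hv => simp only [map_add, hu, hv]
    | tmul a x => simp [convAlong]
  have h2 : ∀ u : A ⊗[ℂ] B, LinearMap.mul' ℂ X
      (TensorProduct.map (convAlong (Coalgebra.comul (R := ℂ)) f g) t u) =
      LinearMap.mul' ℂ X (TensorProduct.map f (LinearMap.mul' ℂ X ∘ₗ TensorProduct.map g t)
        (TensorProduct.assoc ℂ A A B
          ((Coalgebra.comul (R := ℂ) (A := A)).rTensor B u))) := by
    intro u
    induction u with
    | zero => simp
    | add u v hu hv => simp only [map_add, hu, hv]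
    | tmul a x =>
      simp only [TensorProduct.map_tmul, convAlong, LinearMap.comp_apply, LinearMap.mul'_apply,
        LinearMap.rTensor_tmul]
      induction Coalgebra.comul (R := ℂ) a with
      | zero => simp
      | add u v hu hv => simp only [map_add, TensorProduct.add_tmul, hu, hv, add_mul]
      | tmul b c => simp [mul_assoc]
  change LinearMap.mul' ℂ X (TensorProduct.map f (convAlong δ g t) (δ x)) =
    LinearMap.mul' ℂ X (TensorProduct.map _ t (δ x))
  rw [h1, h2, hδ.coassoc]

theorem convAlong_counit (hδ : IsLeftCoaction δ) (t : B →ₗ[ℂ] X) :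
    convAlong δ (Algebra.linearMap ℂ X ∘ₗ Coalgebra.counit) t = t := by
  ext x
  have h1 : ∀ u : A ⊗[ℂ] B, LinearMap.mul' ℂ X
      (TensorProduct.map (Algebra.linearMap ℂ X ∘ₗ Coalgebra.counit) t u) =
      t (TensorProduct.lid ℂ B ((Coalgebra.counit (R := ℂ) (A := A)).rTensor B u)) := by
    intro u
    induction u with
    | zero => simp
    | add u v hu hv => simp only [map_add, hu, hv]
    | tmul a x => simp [Algebra.smul_def]
  change LinearMap.mul' ℂ X (TensorProduct.map _ t (δ x)) = _
  rw [h1, hδ.counit]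
  simp

theorem conv_counit (f : A →ₗ[ℂ] X) :
    convAlong (Coalgebra.comul (R := ℂ)) f (Algebra.linearMap ℂ X ∘ₗ Coalgebra.counit) = f := by
  ext x
  have h1 : ∀ u : A ⊗[ℂ] A, LinearMap.mul' ℂ X
      (TensorProduct.map f (Algebra.linearMap ℂ X ∘ₗ Coalgebra.counit) u) =
      f (TensorProduct.rid ℂ A ((Coalgebra.counit (R := ℂ) (A := A)).lTensor A u)) := by
    intro u
    induction u with
    | zero => simp
    | add u v hu hv => simp only [map_add, hu, hv]
    | tmul a x => simp [Algebra.algebraMap_eq_smul_one]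
  change LinearMap.mul' ℂ X (TensorProduct.map f _ (Coalgebra.comul (R := ℂ) x)) = _
  rw [h1, Coalgebra.lTensor_counit_comul]
  simp

theorem algHom_comp_convAlong (φ : X →ₐ[ℂ] Y) (f : A →ₗ[ℂ] X) (t : B →ₗ[ℂ] X) :
    φ.toLinearMap ∘ₗ convAlong δ f t =
      convAlong δ (φ.toLinearMap ∘ₗ f) (φ.toLinearMap ∘ₗ t) := by
  ext x
  simp only [convAlong, LinearMap.comp_apply]
  induction δ x with
  | zero => simp
  | add u v hu hv => simp only [map_add, hu, hv]
  | tmul a x => simp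

theorem conv_antipode_left (φ : A →ₐ[ℂ] X) :
    convAlong (Coalgebra.comul (R := ℂ)) (φ.toLinearMap ∘ₗ HopfAlgebra.antipode ℂ)
      φ.toLinearMap = Algebra.linearMap ℂ X ∘ₗ Coalgebra.counit := by
  have h := algHom_comp_convAlong (δ := Coalgebra.comul (R := ℂ)) φ
    (HopfAlgebra.antipode ℂ (A := A)) LinearMap.id
  rw [LinearMap.comp_id] at h
  rw [← h]
  ext a
  have := HopfAlgebra.mul_antipode_rTensor_comul_apply (R := ℂ) a
  change φ (LinearMap.mul' ℂ A ((HopfAlgebra.antipode ℂ).rTensor A _)) = _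
  rw [this]
  simp

theorem conv_antipode_right (φ : A →ₐ[ℂ] X) :
    convAlong (Coalgebra.comul (R := ℂ)) φ.toLinearMap
      (φ.toLinearMap ∘ₗ HopfAlgebra.antipode ℂ) = Algebra.linearMap ℂ X ∘ₗ Coalgebra.counit := by
  have h := algHom_comp_convAlong (δ := Coalgebra.comul (R := ℂ)) φ LinearMap.id
    (HopfAlgebra.antipode ℂ (A := A))
  rw [LinearMap.comp_id] at h
  rw [← h]
  ext a
  have := HopfAlgebra.mul_antipode_lTensor_comul_apply (R := ℂ) a
  change φ (LinearMap.mul' ℂ A ((HopfAlgebra.antipode ℂ).lTensor A _)) = _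
  rw [this]
  simp

theorem convAlong_antipode_cancel_left (hδ : IsLeftCoaction δ) (φ : A →ₐ[ℂ] X)
    (t : B →ₗ[ℂ] X) :
    convAlong δ (φ.toLinearMap ∘ₗ HopfAlgebra.antipode ℂ) (convAlong δ φ.toLinearMap t) = t := by
  rw [convAlong_convAlong hδ, conv_antipode_left, convAlong_counit hδ]

theorem convAlong_antipode_cancel_right (hδ : IsLeftCoaction δ) (φ : A →ₐ[ℂ] X)
    (t : B →ₗ[ℂ] X) :
    convAlong δ φ.toLinearMap (convAlong δ (φ.toLinearMap ∘ₗ HopfAlgebra.antipode ℂ) t) = t := by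
  rw [convAlong_convAlong hδ, conv_antipode_right, convAlong_counit hδ]

end Convolution

/-! ### Slices of tensors -/

section Slices

variable {M P : Type*} [AddCommGroup M] [Module ℂ M] [AddCommGroup P] [Module ℂ P]

/-- The slice map `φ ⊗ id`. -/
noncomputable def sliceLeft (φ : M →ₗ[ℂ] ℂ) : M ⊗[ℂ] P →ₗ[ℂ] P :=
  (TensorProduct.lid ℂ P).toLinearMap ∘ₗ φ.rTensor P

/-- The slice map `id ⊗ φ`. -/
noncomputable def sliceRight (φ : P →ₗ[ℂ] ℂ) : M ⊗[ℂ] P →ₗ[ℂ] M :=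
  (TensorProduct.rid ℂ M).toLinearMap ∘ₗ φ.lTensor M

@[simp] theorem sliceLeft_tmul (φ : M →ₗ[ℂ] ℂ) (x : M) (y : P) :
    sliceLeft φ (x ⊗ₜ[ℂ] y) = φ x • y := by simp [sliceLeft]

@[simp] theorem sliceRight_tmul (φ : P →ₗ[ℂ] ℂ) (x : M) (y : P) :
    sliceRight φ (x ⊗ₜ[ℂ] y) = φ y • x := by simp [sliceRight]

/-- The span `C ⊗ D` of the elementary tensors `x ⊗ y` with `x ∈ C` and `y ∈ D`. -/
noncomputable abbrev tensorSpan (C : Submodule ℂ M) (D : Submodule ℂ P) :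
    Submodule ℂ (M ⊗[ℂ] P) :=
  Submodule.map₂ (TensorProduct.mk ℂ M P) C D

theorem map_mem_of_mem_tensorSpan {Q : Type*} [AddCommGroup Q] [Module ℂ Q]
    {C : Submodule ℂ M} {D : Submodule ℂ P} {t : M ⊗[ℂ] P} (ht : t ∈ tensorSpan C D)
    (f : M ⊗[ℂ] P →ₗ[ℂ] Q) {E : Submodule ℂ Q}
    (hf : ∀ x ∈ C, ∀ y ∈ D, f (x ⊗ₜ y) ∈ E) : f t ∈ E := by
  have : tensorSpan C D ≤ E.comap f := Submodule.map₂_le.2 fun x hx y hy => hf x hx y hy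
  exact this ht

theorem mem_tensorSpan_of_sliceLeft {D : Submodule ℂ P} {t : M ⊗[ℂ] P}
    (ht : ∀ φ : M →ₗ[ℂ] ℂ, sliceLeft φ t ∈ D) : t ∈ tensorSpan ⊤ D := by
  classical
  let b := Module.Basis.ofVectorSpace ℂ M
  rw [← (TensorProduct.equivFinsuppOfBasisLeft b).symm_apply_apply t,
    TensorProduct.equivFinsuppOfBasisLeft_symm_apply]
  refine Submodule.sum_mem _ fun i _ => Submodule.apply_mem_map₂ _ trivial ?_
  rw [TensorProduct.equivFinsuppOfBasisLeft_apply]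
  exact ht (b.coord i)

theorem mem_tensorSpan_of_sliceRight {C : Submodule ℂ M} {t : M ⊗[ℂ] P}
    (ht : ∀ φ : P →ₗ[ℂ] ℂ, sliceRight φ t ∈ C) : t ∈ tensorSpan C ⊤ := by
  classical
  let b := Module.Basis.ofVectorSpace ℂ P
  rw [← (TensorProduct.equivFinsuppOfBasisRight b).symm_apply_apply t,
    TensorProduct.equivFinsuppOfBasisRight_symm_apply]
  refine Submodule.sum_mem _ fun i _ => Submodule.apply_mem_map₂ _ ?_ trivial
  rw [TensorProduct.equivFinsuppOfBasisRight_apply]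
  exact ht (b.coord i)

theorem eq_zero_of_sliceLeft {t : M ⊗[ℂ] P} (ht : ∀ φ : M →ₗ[ℂ] ℂ, sliceLeft φ t = 0) :
    t = 0 := by
  have h := mem_tensorSpan_of_sliceLeft (D := ⊥) (t := t) fun φ => by simp [ht φ]
  simpa using h

end Slices

/-! ### Invariant functionals and the antipode -/

section InvariantFunctionals

open Coalgebra HopfAlgebra

variable {A B : Type*} [Ring A] [HopfAlgebra ℂ A] [Ring B] [Algebra ℂ B]

theorem convAlong_includeLeft_includeRight (δ : B →ₗ[ℂ] A ⊗[ℂ] B) :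
    convAlong δ (Algebra.TensorProduct.includeLeft : A →ₐ[ℂ] A ⊗[ℂ] B).toLinearMap
      (Algebra.TensorProduct.includeRight : B →ₐ[ℂ] A ⊗[ℂ] B).toLinearMap = δ := by
  ext x
  simp only [convAlong, LinearMap.comp_apply]
  induction δ x with
  | zero => simp
  | add u v hu hv => simp only [map_add, hu, hv]
  | tmul a x => simp

/-- The identity `(S(x₁) ⊗ 1) δ(x₂) = 1 ⊗ x` for a coaction `δ`. -/
theorem convAlong_antipode_coaction {δ : B →ₗ[ℂ] A ⊗[ℂ] B} (hδ : IsLeftCoaction δ) :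
    convAlong δ ((Algebra.TensorProduct.includeLeft : A →ₐ[ℂ] A ⊗[ℂ] B).toLinearMap ∘ₗ
      antipode ℂ) δ = (Algebra.TensorProduct.includeRight : B →ₐ[ℂ] A ⊗[ℂ] B).toLinearMap := by
  have h := convAlong_antipode_cancel_left hδ
    (Algebra.TensorProduct.includeLeft : A →ₐ[ℂ] A ⊗[ℂ] B)
    (Algebra.TensorProduct.includeRight : B →ₐ[ℂ] A ⊗[ℂ] B).toLinearMap
  rwa [convAlong_includeLeft_includeRight δ] at h

/-- The functional `I` is invariant for the coaction `δ`: `(id ⊗ I)δ(x) = I(x)1`. -/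
def IsInvariantFunctional (δ : B →ₗ[ℂ] A ⊗[ℂ] B) (I : B →ₗ[ℂ] ℂ) : Prop :=
  ∀ x, sliceRight I (δ x) = I x • (1 : A)

/-- Strong left invariance: `y₁ I(x y₂) = S(x₁) I(x₂ y)`. -/
theorem IsInvariantFunctional.strong {δ : B →ₐ[ℂ] A ⊗[ℂ] B} (hδ : IsLeftCoaction δ.toLinearMap)
    {I : B →ₗ[ℂ] ℂ} (hI : IsInvariantFunctional δ.toLinearMap I) (x y : B) :
    sliceRight I (((1 : A) ⊗ₜ[ℂ] x) * δ y) =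
      antipode ℂ (sliceRight I (δ x * ((1 : A) ⊗ₜ[ℂ] y))) := by
  have h0 : (1 : A) ⊗ₜ[ℂ] x = convAlong δ.toLinearMap
      ((Algebra.TensorProduct.includeLeft : A →ₐ[ℂ] A ⊗[ℂ] B).toLinearMap ∘ₗ antipode ℂ)
      δ.toLinearMap x := by
    rw [convAlong_antipode_coaction hδ]; simp
  rw [h0]
  simp only [convAlong, LinearMap.comp_apply]
  change sliceRight I (LinearMap.mul' ℂ _ (TensorProduct.map _ _ (δ x)) * _) = _
  induction δ x with
  | zero => simp
  | add u v hu hv => simp only [map_add, add_mul, hu, hv]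
  | tmul a z =>
    have h1 : ∀ (s : A) (w : A ⊗[ℂ] B),
        sliceRight I ((s ⊗ₜ[ℂ] (1 : B)) * w) = s * sliceRight I w := by
      intro s w
      induction w with
      | zero => simp
      | add u v hu hv => simp only [map_add, mul_add, hu, hv]
      | tmul b c => simp
    have h2 := hI (z * y)
    simp only [AlgHom.toLinearMap_apply, map_mul] at h2
    simp [mul_assoc, h1, h2]

/-- Strong right invariance: `h(x₁ p) x₂ = h(x p₁) S(p₂)`. -/
theorem strong_right_invariance {h : A →ₗ[ℂ] ℂ}
    (hh : ∀ a : A, sliceLeft h (comul (R := ℂ) a) = h a • (1 : A)) (x p : A) :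
    sliceLeft h (comul (R := ℂ) x * (p ⊗ₜ[ℂ] (1 : A))) =
      antipode ℂ (sliceLeft h ((x ⊗ₜ[ℂ] (1 : A)) * comul (R := ℂ) p)) := by
  have h0 : p ⊗ₜ[ℂ] (1 : A) = convAlong (comul (R := ℂ)) (comul (R := ℂ))
      ((Algebra.TensorProduct.includeRight : A →ₐ[ℂ] A ⊗[ℂ] A).toLinearMap ∘ₗ antipode ℂ) p := by
    have e : ∀ g : A →ₗ[ℂ] A ⊗[ℂ] A, convAlong (comul (R := ℂ)) (comul (R := ℂ)) g =
        convAlong (comul (R := ℂ)) (convAlong (comul (R := ℂ))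
          (Algebra.TensorProduct.includeLeft : A →ₐ[ℂ] A ⊗[ℂ] A).toLinearMap
          (Algebra.TensorProduct.includeRight : A →ₐ[ℂ] A ⊗[ℂ] A).toLinearMap) g := fun g => by
      rw [convAlong_includeLeft_includeRight]
    rw [e, ← convAlong_convAlong isLeftCoaction_comul, conv_antipode_right, conv_counit]
    simp
  rw [h0]
  simp only [convAlong, LinearMap.comp_apply]
  induction comul (R := ℂ) p with
  | zero => simp
  | add u v hu hv => simp only [map_add, mul_add, hu, hv]
  | tmul a z =>
    have h1 : ∀ (s : A) (w : A ⊗[ℂ] A),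
        sliceLeft h (w * ((1 : A) ⊗ₜ[ℂ] s)) = sliceLeft h w * s := by
      intro s w
      induction w with
      | zero => simp
      | add u v hu hv => simp only [map_add, add_mul, hu, hv]
      | tmul b c => simp
    have h2 := hh (x * a)
    rw [Bialgebra.comul_mul] at h2
    simp [← mul_assoc, h1, h2]

theorem counit_sliceLeft_comul (φ : A →ₗ[ℂ] ℂ) (a : A) :
    counit (R := ℂ) (sliceLeft φ (comul (R := ℂ) a)) = φ a := by
  have h1 : ∀ t : A ⊗[ℂ] A, counit (R := ℂ) (sliceLeft φ t) =
      φ (TensorProduct.rid ℂ A ((counit (R := ℂ)).lTensor A t)) := by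
    intro t
    induction t with
    | zero => simp
    | add u v hu hv => simp only [map_add, hu, hv]
    | tmul b c => simp [mul_comm]
  rw [h1, lTensor_counit_comul]
  simp

end InvariantFunctionals

/-! ### The Haar integral -/

namespace IsPositiveHaarIntegral

open Coalgebra HopfAlgebra

variable {A : Type*} [Ring A] [StarRing A] [HopfAlgebra ℂ A] {h : A →ₗ[ℂ] ℂ}

theorem isInvariantFunctional (hh : IsPositiveHaarIntegral h) :
    IsInvariantFunctional (Bialgebra.comulAlgHom ℂ A).toLinearMap h := fun a => hh.id_tensor a

theorem slice_left (hh : IsPositiveHaarIntegral h) (a : A) :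
    sliceLeft h (comul (R := ℂ) a) = h a • (1 : A) := hh.tensor_id a

theorem strong_left (hh : IsPositiveHaarIntegral h) (x y : A) :
    sliceRight h (((1 : A) ⊗ₜ[ℂ] x) * comul (R := ℂ) y) =
      antipode ℂ (sliceRight h (comul (R := ℂ) x * ((1 : A) ⊗ₜ[ℂ] y))) :=
  IsInvariantFunctional.strong (δ := Bialgebra.comulAlgHom ℂ A) isLeftCoaction_comul
    hh.isInvariantFunctional x y

/-- The Haar integral is faithful as a bilinear form: the elements `a` with `h(ba) = 0` for all
`b` form a subspace that is stable under the slices `a ↦ φ(a₁) a₂` and on which the counit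
`ε(a) = h(S(a₁) a₂)` vanishes. -/
theorem eq_zero_of_forall_mul_left (hh : IsPositiveHaarIntegral h) {a : A}
    (ha : ∀ b, h (b * a) = 0) : a = 0 := by
  let N : Submodule ℂ A :=
    { carrier := {a | ∀ b, h (b * a) = 0}
      add_mem' := fun {x y} hx hy b => by rw [mul_add, map_add, hx b, hy b, add_zero]
      zero_mem' := fun b => by simp
      smul_mem' := fun c x hx b => by rw [mul_smul_comm, map_smul, hx b, smul_zero] }
  have hN : ∀ a ∈ N, ∀ φ : A →ₗ[ℂ] ℂ, sliceLeft φ (comul (R := ℂ) a) ∈ N := by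
    intro a ha φ b
    have h1 : ∀ t : A ⊗[ℂ] A, h (b * sliceLeft φ t) =
        φ (sliceRight h (((1 : A) ⊗ₜ[ℂ] b) * t)) := by
      intro t
      induction t with
      | zero => simp
      | add u v hu hv => simp only [map_add, mul_add, hu, hv]
      | tmul b c => simp [mul_comm]
    have h2 : ∀ t : A ⊗[ℂ] A, sliceRight h (t * ((1 : A) ⊗ₜ[ℂ] a)) = 0 := by
      intro t
      induction t with
      | zero => simp
      | add u v hu hv => simp only [map_add, add_mul, hu, hv, add_zero]
      | tmul b c => simp [ha c]
    rw [h1, hh.strong_left, h2, map_zero, map_zero]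
  have hε : ∀ a ∈ N, counit (R := ℂ) a = 0 := by
    intro a ha
    have h1 : h (LinearMap.mul' ℂ A ((antipode ℂ).rTensor A (comul a))) = 0 := by
      have := map_mem_of_mem_tensorSpan (mem_tensorSpan_of_sliceLeft (hN a ha))
        (h ∘ₗ LinearMap.mul' ℂ A ∘ₗ (antipode ℂ).rTensor A) (E := ⊥)
        (fun x _ y hy => by simpa using hy (antipode ℂ x))
      simpa using this
    rw [mul_antipode_rTensor_comul_apply, Algebra.algebraMap_eq_smul_one, map_smul, hh.map_one]
      at h1
    simpa using h1
  refine (Module.forall_dual_apply_eq_zero_iff ℂ a).1 fun φ => ?_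
  rw [← counit_sliceLeft_comul φ a]
  exact hε _ (hN a ha φ)

section Hermitian

variable [StarModule ℂ A]

/-- Positivity at `a + 1` and at `a + i` forces `h(a*) + h(a)` and `i(h(a*) - h(a))` to be real. -/
theorem map_star (hh : IsPositiveHaarIntegral h) (a : A) : h (star a) = conj (h a) := by
  have im_zero : ∀ b : A, (h (star b * b)).im = 0 := fun b =>
    ((Complex.nonneg_iff.1 (hh.nonneg b)).2).symm
  have e1 : h (star (a + 1) * (a + 1)) = h (star a * a) + h (star a) + h a + 1 := by
    simp only [star_add, star_one, add_mul, mul_add, mul_one, one_mul, map_add, hh.map_one]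
    ring
  have e2 : h (star (a + Complex.I • 1) * (a + Complex.I • 1)) =
      h (star a * a) + Complex.I * h (star a) - Complex.I * h a + 1 := by
    simp only [star_add, star_smul, star_one, add_mul, mul_add, mul_one, one_mul, map_add,
      hh.map_one, smul_mul_assoc, mul_smul_comm, map_smul, smul_eq_mul]
    have : star Complex.I * Complex.I = 1 := by simp
    have : star Complex.I = -Complex.I := by simp
    rw [this]
    linear_combination -Complex.I_mul_I
  have h0 := im_zero a
  have h1 := im_zero (a + 1)
  have h2 := im_zero (a + Complex.I • 1)
  rw [e1] at h1
  rw [e2] at h2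
  simp at h1 h2
  apply Complex.ext
  · simp; linarith
  · simp; linarith

/-- The positive semidefinite form `h(a* b)`. -/
noncomputable abbrev preCore (hh : IsPositiveHaarIntegral h) : PreInnerProductSpace.Core ℂ A where
  inner a b := h (star a * b)
  conj_inner_symm a b := by rw [← hh.map_star]; simp
  re_inner_nonneg a := (Complex.nonneg_iff.1 (hh.nonneg a)).1
  add_left a b c := by simp [add_mul]
  smul_left a b c := by simp

/-- The Haar integral is faithful: by the Cauchy–Schwarz inequality `h(a* a) = 0` implies
`h(ba) = 0` for all `b`. -/
theorem eq_zero_of_star_mul_self (hh : IsPositiveHaarIntegral h) {a : A}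
    (ha : h (star a * a) = 0) : a = 0 := by
  refine hh.eq_zero_of_forall_mul_left fun b => ?_
  have := @InnerProductSpace.Core.inner_mul_inner_self_le ℂ A _ _ _ hh.preCore (star b) a
  have e' : ‖h (star (star b) * a)‖ * ‖h (star a * star b)‖ ≤
    (h (star (star b) * star b)).re * (h (star a * a)).re := this
  rw [ha, star_star, ← star_mul, hh.map_star] at e'
  simp only [Complex.zero_re, mul_zero, RCLike.norm_conj] at e'
  have := norm_nonneg (h (b * a))
  exact norm_eq_zero.1 (by nlinarith)

theorem eq_zero_of_forall_mul_right (hh : IsPositiveHaarIntegral h) {a : A}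
    (ha : ∀ b, h (a * b) = 0) : a = 0 := by
  refine star_eq_zero.1 (hh.eq_zero_of_forall_mul_left fun b => ?_)
  rw [← star_star b, ← star_mul, hh.map_star, ha, map_zero]

end Hermitian

/-! ### The modular automorphism of the Haar integral -/

/-- The element `p₁ h(q S(p₂))`. -/
noncomputable def modularSource (h : A →ₗ[ℂ] ℂ) (p q : A) : A :=
  sliceRight (h ∘ₗ LinearMap.mulLeft ℂ q ∘ₗ antipode ℂ) (comul (R := ℂ) p)

/-- The element `h(S(q₁) p) q₂`. -/
noncomputable def modularTarget (h : A →ₗ[ℂ] ℂ) (p q : A) : A :=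
  sliceLeft (h ∘ₗ LinearMap.mulRight ℂ p ∘ₗ antipode ℂ) (comul (R := ℂ) q)

/-- Both sides are equal to `h(x₁ p) h(q x₂)`, by strong right and strong left invariance. -/
theorem mul_modularSource (hh : IsPositiveHaarIntegral h) (p q x : A) :
    h (x * modularSource h p q) = h (modularTarget h p q * x) := by
  have h1 : ∀ t : A ⊗[ℂ] A,
      h (x * sliceRight (h ∘ₗ LinearMap.mulLeft ℂ q ∘ₗ antipode ℂ) t) =
        h (q * antipode ℂ (sliceLeft h ((x ⊗ₜ[ℂ] (1 : A)) * t))) := by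
    intro t
    induction t with
    | zero => simp
    | add u v hu hv => simp only [map_add, mul_add, hu, hv]
    | tmul b c => simp [mul_comm]
  have h2 : ∀ t : A ⊗[ℂ] A, h (q * sliceLeft h (t * (p ⊗ₜ[ℂ] (1 : A)))) =
      h (sliceRight h (((1 : A) ⊗ₜ[ℂ] q) * t) * p) := by
    intro t
    induction t with
    | zero => simp
    | add u v hu hv => simp only [map_add, mul_add, add_mul, hu, hv]
    | tmul b c => simp [mul_comm]
  have h3 : ∀ t : A ⊗[ℂ] A,
      h (antipode ℂ (sliceRight h (t * ((1 : A) ⊗ₜ[ℂ] x))) * p) =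
      h (sliceLeft (h ∘ₗ LinearMap.mulRight ℂ p ∘ₗ antipode ℂ) t * x) := by
    intro t
    induction t with
    | zero => simp
    | add u v hu hv => simp only [map_add, add_mul, hu, hv]
    | tmul b c => simp [mul_comm]
  rw [modularSource, modularTarget, h1, ← strong_right_invariance hh.slice_left, h2,
    hh.strong_left, h3]

/-- The linear map sending `x ⊗ y` to `h(S(q₁) x) q₂` with `q = S²(y)`. Its value at `Δ(a)` is the
image `σ_h(a)` of `a` under the modular automorphism. -/
noncomputable def modularMap (h : A →ₗ[ℂ] ℂ) : A ⊗[ℂ] A →ₗ[ℂ] A :=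
  TensorProduct.lift (LinearMap.mk₂ ℂ (fun x y => modularTarget h x (antipode ℂ (antipode ℂ y)))
    (fun x x' y => by
      simp only [modularTarget]
      induction comul (R := ℂ) (antipode ℂ (antipode ℂ y)) with
      | zero => simp
      | add u v hu hv => simp only [map_add, hu, hv]; abel
      | tmul b c => simp [mul_add, add_smul])
    (fun c x y => by
      simp only [modularTarget]
      induction comul (R := ℂ) (antipode ℂ (antipode ℂ y)) with
      | zero => simp
      | add u v hu hv => simp only [map_add, hu, hv, smul_add]
      | tmul b c => simp [mul_smul])
    (fun x y y' => by simp [modularTarget])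
    (fun c x y => by simp [modularTarget]))

/-- The element `a` is recovered as `p₁ h(q S(p₂))` with `p ⊗ q = a₁ ⊗ S²(a₂)`. -/
theorem mul_eq_modularMap_mul (hh : IsPositiveHaarIntegral h) (a x : A) :
    h (x * a) = h (modularMap h (comul (R := ℂ) a) * x) := by
  let K : A ⊗[ℂ] (A ⊗[ℂ] A) →ₗ[ℂ] A :=
    sliceRight (h ∘ₗ antipode ℂ ∘ₗ LinearMap.mul' ℂ A ∘ₗ (antipode ℂ).lTensor A)
  have hK : K ((comul (R := ℂ)).lTensor A (comul (R := ℂ) a)) = a := by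
    have h1 : ∀ t : A ⊗[ℂ] A, K ((comul (R := ℂ)).lTensor A t) =
        TensorProduct.rid ℂ A ((counit (R := ℂ)).lTensor A t) := by
      intro t
      induction t with
      | zero => simp
      | add u v hu hv => simp only [map_add, hu, hv]
      | tmul b c => simp [K, Algebra.algebraMap_eq_smul_one, hh.map_one]
    rw [h1, lTensor_counit_comul]
    simp
  have h2 : ∀ t : A ⊗[ℂ] A,
      h (x * K (TensorProduct.assoc ℂ A A A ((comul (R := ℂ)).rTensor A t))) =
        h (modularMap h t * x) := by
    intro t
    induction t with
    | zero => simp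
    | add u v hu hv => simp only [map_add, mul_add, add_mul, hu, hv]
    | tmul b c =>
      have e : modularMap h (b ⊗ₜ c) = modularTarget h b (antipode ℂ (antipode ℂ c)) := rfl
      rw [e, ← hh.mul_modularSource, modularSource, LinearMap.rTensor_tmul]
      congr 2
      induction comul (R := ℂ) b with
      | zero => simp
      | add u v hu hv => simp only [map_add, TensorProduct.add_tmul, hu, hv]
      | tmul b' c' => simp [K, antipode_mul_antidistrib]
  rw [← h2, coassoc_apply, hK]

end IsPositiveHaarIntegral

/-! ### Finite-dimensional subcoalgebras -/

section Bicoideals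

open Coalgebra HopfAlgebra

variable {A : Type*} [Ring A] [HopfAlgebra ℂ A]

/-- A subspace `C` stable under the slices `a ↦ φ(a₁) a₂` and `a ↦ a₁ ψ(a₂)`, which amounts to
`Δ(C) ⊆ C ⊗ C`. -/
structure IsSliceStable (C : Submodule ℂ A) : Prop where
  left : ∀ a ∈ C, ∀ φ : A →ₗ[ℂ] ℂ, sliceLeft φ (comul (R := ℂ) a) ∈ C
  right : ∀ a ∈ C, ∀ φ : A →ₗ[ℂ] ℂ, sliceRight φ (comul (R := ℂ) a) ∈ C

theorem sliceLeft_comul_sliceRight_comul (φ ψ : A →ₗ[ℂ] ℂ) (a : A) :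
    sliceLeft φ (comul (R := ℂ) (sliceRight ψ (comul (R := ℂ) a))) =
      sliceRight ψ (comul (R := ℂ) (sliceLeft φ (comul (R := ℂ) a))) := by
  have h1 : ∀ t : A ⊗[ℂ] A, sliceLeft φ (comul (R := ℂ) (sliceRight ψ t)) =
      sliceRight ψ (sliceLeft φ (TensorProduct.assoc ℂ A A A ((comul (R := ℂ)).rTensor A t))) := by
    intro t
    induction t with
    | zero => simp
    | add u v hu hv => simp only [map_add, hu, hv]
    | tmul b c =>
      simp only [sliceRight_tmul, map_smul, LinearMap.rTensor_tmul]
      induction comul (R := ℂ) b with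
      | zero => simp
      | add u v hu hv => simp only [map_add, TensorProduct.add_tmul, smul_add, hu, hv]
      | tmul b' c' => simp [smul_smul, mul_comm]
  have h2 : ∀ t : A ⊗[ℂ] A, sliceRight ψ (comul (R := ℂ) (sliceLeft φ t)) =
      sliceRight ψ (sliceLeft φ ((comul (R := ℂ)).lTensor A t)) := by
    intro t
    induction t with
    | zero => simp
    | add u v hu hv => simp only [map_add, hu, hv]
    | tmul b c => simp
  rw [h1, h2, coassoc_apply]

theorem sliceLeft_comul_sliceLeft_comul (φ ψ : A →ₗ[ℂ] ℂ) (a : A) :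
    sliceLeft φ (comul (R := ℂ) (sliceLeft ψ (comul (R := ℂ) a))) =
      sliceLeft (LinearMap.mul' ℂ ℂ ∘ₗ TensorProduct.map ψ φ ∘ₗ comul (R := ℂ))
        (comul (R := ℂ) a) := by
  have h1 : ∀ t : A ⊗[ℂ] A, sliceLeft φ (comul (R := ℂ) (sliceLeft ψ t)) =
      sliceLeft φ (sliceLeft ψ ((comul (R := ℂ)).lTensor A t)) := by
    intro t
    induction t with
    | zero => simp
    | add u v hu hv => simp only [map_add, hu, hv]
    | tmul b c => simp
  have h2 : ∀ t : A ⊗[ℂ] A,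
      sliceLeft (LinearMap.mul' ℂ ℂ ∘ₗ TensorProduct.map ψ φ ∘ₗ comul (R := ℂ)) t =
      sliceLeft φ (sliceLeft ψ
        (TensorProduct.assoc ℂ A A A ((comul (R := ℂ)).rTensor A t))) := by
    intro t
    induction t with
    | zero => simp
    | add u v hu hv => simp only [map_add, hu, hv]
    | tmul b c =>
      simp only [sliceLeft_tmul, LinearMap.comp_apply, LinearMap.rTensor_tmul]
      induction comul (R := ℂ) b with
      | zero => simp
      | add u v hu hv => simp only [map_add, TensorProduct.add_tmul, add_smul, hu, hv]
      | tmul b' c' => simp [smul_smul]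
  rw [h1, h2, coassoc_apply]

theorem sliceRight_comul_sliceRight_comul (φ ψ : A →ₗ[ℂ] ℂ) (a : A) :
    sliceRight φ (comul (R := ℂ) (sliceRight ψ (comul (R := ℂ) a))) =
      sliceRight (LinearMap.mul' ℂ ℂ ∘ₗ TensorProduct.map φ ψ ∘ₗ comul (R := ℂ))
        (comul (R := ℂ) a) := by
  have h1 : ∀ t : A ⊗[ℂ] A,
      sliceRight (LinearMap.mul' ℂ ℂ ∘ₗ TensorProduct.map φ ψ ∘ₗ comul (R := ℂ)) t =
      sliceRight (LinearMap.mul' ℂ ℂ ∘ₗ TensorProduct.map φ ψ)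
        ((comul (R := ℂ)).lTensor A t) := by
    intro t
    induction t with
    | zero => simp
    | add u v hu hv => simp only [map_add, hu, hv]
    | tmul b c => simp
  have h2 : ∀ t : A ⊗[ℂ] A, sliceRight φ (comul (R := ℂ) (sliceRight ψ t)) =
      sliceRight (LinearMap.mul' ℂ ℂ ∘ₗ TensorProduct.map φ ψ)
        (TensorProduct.assoc ℂ A A A ((comul (R := ℂ)).rTensor A t)) := by
    intro t
    induction t with
    | zero => simp
    | add u v hu hv => simp only [map_add, hu, hv]
    | tmul b c =>
      simp only [sliceRight_tmul, map_smul, LinearMap.rTensor_tmul]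
      induction comul (R := ℂ) b with
      | zero => simp
      | add u v hu hv => simp only [map_add, TensorProduct.add_tmul, smul_add, hu, hv]
      | tmul b' c' => simp [smul_smul, mul_comm]
  rw [h1, h2, coassoc_apply]

theorem exists_finiteDimensional_sliceRight_mem (t : A ⊗[ℂ] A) :
    ∃ W : Submodule ℂ A, FiniteDimensional ℂ W ∧ ∀ ψ : A →ₗ[ℂ] ℂ, sliceRight ψ t ∈ W := by
  induction t with
  | zero => exact ⟨⊥, inferInstance, fun ψ => by simp⟩
  | add u v hu hv =>
    obtain ⟨U, _, hU⟩ := hu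
    obtain ⟨V, _, hV⟩ := hv
    refine ⟨U ⊔ V, inferInstance, fun ψ => ?_⟩
    rw [map_add]
    exact Submodule.add_mem_sup (hU ψ) (hV ψ)
  | tmul x y =>
    refine ⟨ℂ ∙ x, inferInstance, fun ψ => ?_⟩
    rw [sliceRight_tmul]
    exact Submodule.smul_mem _ _ (Submodule.mem_span_singleton_self x)

theorem exists_finiteDimensional_slices_mem (t : A ⊗[ℂ] (A ⊗[ℂ] A)) :
    ∃ W : Submodule ℂ A, FiniteDimensional ℂ W ∧
      ∀ φ ψ : A →ₗ[ℂ] ℂ, sliceRight ψ (sliceLeft φ t) ∈ W := by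
  induction t with
  | zero => exact ⟨⊥, inferInstance, fun φ ψ => by simp⟩
  | add u v hu hv =>
    obtain ⟨U, _, hU⟩ := hu
    obtain ⟨V, _, hV⟩ := hv
    refine ⟨U ⊔ V, inferInstance, fun φ ψ => ?_⟩
    rw [map_add, map_add]
    exact Submodule.add_mem_sup (hU φ ψ) (hV φ ψ)
  | tmul x u =>
    obtain ⟨W, hW, h⟩ := exists_finiteDimensional_sliceRight_mem u
    refine ⟨W, hW, fun φ ψ => ?_⟩
    rw [sliceLeft_tmul, map_smul]
    exact W.smul_mem _ (h ψ)

/-- The subcoalgebra generated by `a`, spanned by the elements `φ(a₁) a₂ ψ(a₃)`. -/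
noncomputable def sliceSpan (a : A) : Submodule ℂ A :=
  Submodule.span ℂ {x | ∃ φ ψ : A →ₗ[ℂ] ℂ,
    x = sliceLeft φ (comul (R := ℂ) (sliceRight ψ (comul (R := ℂ) a)))}

instance (a : A) : FiniteDimensional ℂ (sliceSpan a) := by
  obtain ⟨W, _, h⟩ := exists_finiteDimensional_slices_mem
    ((comul (R := ℂ)).lTensor A (comul (R := ℂ) a))
  refine Submodule.finiteDimensional_of_le (S₂ := W) (Submodule.span_le.2 ?_)
  rintro _ ⟨φ, ψ, rfl⟩
  have h2 : ∀ t : A ⊗[ℂ] A, comul (R := ℂ) (sliceLeft φ t) =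
      sliceLeft φ ((comul (R := ℂ)).lTensor A t) := by
    intro t
    induction t with
    | zero => simp
    | add u v hu hv => simp only [map_add, hu, hv]
    | tmul b c => simp
  rw [sliceLeft_comul_sliceRight_comul, h2]
  exact h φ ψ

theorem sliceRight_counit_comul (a : A) :
    sliceRight (counit (R := ℂ)) (comul (R := ℂ) a) = a := by
  simp [sliceRight]

theorem sliceLeft_counit_comul (a : A) :
    sliceLeft (counit (R := ℂ)) (comul (R := ℂ) a) = a := by
  simp [sliceLeft]

theorem self_mem_sliceSpan (a : A) : a ∈ sliceSpan a :=
  Submodule.subset_span ⟨counit, counit, by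
    rw [sliceRight_counit_comul, sliceLeft_counit_comul]⟩

theorem isSliceStable_sliceSpan (a : A) : IsSliceStable (sliceSpan a) where
  left x hx φ' := by
    have : sliceSpan a ≤ (sliceSpan a).comap (sliceLeft φ' ∘ₗ comul) := by
      refine Submodule.span_le.2 ?_
      rintro _ ⟨φ, ψ, rfl⟩
      refine Submodule.subset_span ⟨LinearMap.mul' ℂ ℂ ∘ₗ TensorProduct.map φ φ' ∘ₗ comul, ψ, ?_⟩
      exact sliceLeft_comul_sliceLeft_comul φ' φ _
    exact this hx
  right x hx ψ' := by
    have : sliceSpan a ≤ (sliceSpan a).comap (sliceRight ψ' ∘ₗ comul) := by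
      refine Submodule.span_le.2 ?_
      rintro _ ⟨φ, ψ, rfl⟩
      refine Submodule.subset_span ⟨φ, LinearMap.mul' ℂ ℂ ∘ₗ TensorProduct.map ψ' ψ ∘ₗ comul, ?_⟩
      change sliceRight ψ' (comul _) = _
      rw [← sliceLeft_comul_sliceRight_comul, sliceRight_comul_sliceRight_comul]
    exact this hx

theorem IsSliceStable.sup {C D : Submodule ℂ A} (hC : IsSliceStable C) (hD : IsSliceStable D) :
    IsSliceStable (C ⊔ D) where
  left x hx φ := by
    obtain ⟨c, hc, d, hd, rfl⟩ := Submodule.mem_sup.1 hx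
    rw [map_add, map_add]
    exact Submodule.add_mem_sup (hC.left c hc φ) (hD.left d hd φ)
  right x hx φ := by
    obtain ⟨c, hc, d, hd, rfl⟩ := Submodule.mem_sup.1 hx
    rw [map_add, map_add]
    exact Submodule.add_mem_sup (hC.right c hc φ) (hD.right d hd φ)

variable [StarRing A] [StarModule ℂ A] [IsHopfStarAlgebra A]

/-- The functional `x ↦ conj φ(x*)`. -/
noncomputable def conjFunctional (φ : A →ₗ[ℂ] ℂ) : A →ₗ[ℂ] ℂ where
  toFun x := conj (φ (star x))
  map_add' x y := by simp
  map_smul' c x := by simp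

theorem star_sliceLeft_comul (φ : A →ₗ[ℂ] ℂ) (a : A) :
    star (sliceLeft φ (comul (R := ℂ) a)) =
      sliceLeft (conjFunctional φ) (comul (R := ℂ) (star a)) := by
  rw [IsHopfStarAlgebra.comul_star]
  induction comul (R := ℂ) a with
  | zero => simp
  | add u v hu hv => simp only [map_add, star_add, hu, hv]
  | tmul b c => simp [conjFunctional]

theorem star_sliceRight_comul (φ : A →ₗ[ℂ] ℂ) (a : A) :
    star (sliceRight φ (comul (R := ℂ) a)) =
      sliceRight (conjFunctional φ) (comul (R := ℂ) (star a)) := by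
  rw [IsHopfStarAlgebra.comul_star]
  induction comul (R := ℂ) a with
  | zero => simp
  | add u v hu hv => simp only [map_add, star_add, hu, hv]
  | tmul b c => simp [conjFunctional]

theorem star_mem_sliceSpan {a x : A} (hx : x ∈ sliceSpan a) : star x ∈ sliceSpan (star a) := by
  have : sliceSpan a ≤ ((sliceSpan (star a)).comap (starLinearEquiv ℂ (A := A)).toLinearMap) := by
    refine Submodule.span_le.2 ?_
    rintro _ ⟨φ, ψ, rfl⟩
    refine Submodule.subset_span ⟨conjFunctional φ, conjFunctional ψ, ?_⟩
    rw [← star_sliceRight_comul, ← star_sliceLeft_comul]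
    rfl
  exact this hx

/-- Every element of a Hopf `*`-algebra lies in a finite-dimensional `*`-invariant
subcoalgebra. -/
theorem exists_finiteDimensional_sliceStable (a : A) :
    ∃ C : Submodule ℂ A, a ∈ C ∧ FiniteDimensional ℂ C ∧ IsSliceStable C ∧
      ∀ x ∈ C, star x ∈ C := by
  refine ⟨sliceSpan a ⊔ sliceSpan (star a), Submodule.mem_sup_left (self_mem_sliceSpan a),
    inferInstance, (isSliceStable_sliceSpan a).sup (isSliceStable_sliceSpan _), fun x hx => ?_⟩
  obtain ⟨c, hc, d, hd, rfl⟩ := Submodule.mem_sup.1 hx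
  rw [star_add, add_comm]
  refine Submodule.add_mem_sup ?_ (star_mem_sliceSpan hc)
  simpa using star_mem_sliceSpan hd

end Bicoideals

namespace IsPositiveHaarIntegral

open Coalgebra HopfAlgebra

variable {A : Type*} [Ring A] [StarRing A] [HopfAlgebra ℂ A] [StarModule ℂ A] {h : A →ₗ[ℂ] ℂ}

/-- The antipode preserves every finite-dimensional `*`-invariant subcoalgebra `C`. Since `h` is
nondegenerate on `C`, there is `b ∈ C` with `h(yb) = ε(y)` for `y ∈ C`, and then
`y = h(y₁ b) y₂ = S(h(y b₁) b₂)` shows `C ⊆ S(C)`. -/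
theorem antipode_mem (hh : IsPositiveHaarIntegral h) {C : Submodule ℂ A}
    [FiniteDimensional ℂ C] (hC : IsSliceStable C) (hstar : ∀ x ∈ C, star x ∈ C) {a : A}
    (ha : a ∈ C) : antipode ℂ a ∈ C := by
  let F : C →ₗ[ℂ] Module.Dual ℂ C := LinearMap.mk₂ ℂ (fun b y => h (y * b))
    (fun b b' y => by simp [mul_add]) (fun c b y => by simp)
    (fun b y y' => by simp [add_mul]) (fun c b y => by simp)
  have hF : Function.Injective F := by
    refine (injective_iff_map_eq_zero F).2 fun b hb => ?_
    have := LinearMap.congr_fun hb ⟨star (b : A), hstar _ b.2⟩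
    exact Subtype.ext (hh.eq_zero_of_star_mul_self this)
  obtain ⟨b, hb⟩ := (LinearMap.injective_iff_surjective_of_finrank_eq_finrank
    (Subspace.dual_finrank_eq (K := ℂ) (V := C)).symm).1 hF (counit (R := ℂ) ∘ₗ C.subtype)
  have hb' : ∀ y ∈ C, h (y * b) = counit (R := ℂ) y := fun y hy =>
    LinearMap.congr_fun hb ⟨y, hy⟩
  -- equality holds in `C ⊆ S(C)` by counting dimensions
  have hle : C ≤ C.map (antipode ℂ) := by
    intro y hy
    have h1 : sliceLeft h (comul (R := ℂ) y * ((b : A) ⊗ₜ[ℂ] (1 : A))) = y := by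
      have h2 := map_mem_of_mem_tensorSpan (mem_tensorSpan_of_sliceRight (hC.right y hy))
        (sliceLeft h ∘ₗ LinearMap.mulRight ℂ ((b : A) ⊗ₜ[ℂ] (1 : A)) -
          sliceLeft (counit (R := ℂ))) (E := ⊥) (fun x hx z _ => by simp [hb' x hx])
      rw [Submodule.mem_bot, LinearMap.sub_apply, sliceLeft_counit_comul, sub_eq_zero] at h2
      exact h2
    have h3 : sliceLeft h ((y ⊗ₜ[ℂ] (1 : A)) * comul (R := ℂ) (b : A)) =
        sliceLeft (h ∘ₗ LinearMap.mulLeft ℂ y) (comul (R := ℂ) (b : A)) := by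
      induction comul (R := ℂ) (b : A) with
      | zero => simp
      | add u v hu hv => simp only [map_add, mul_add, hu, hv]
      | tmul b c => simp
    rw [strong_right_invariance hh.slice_left, h3] at h1
    exact ⟨_, hC.left _ b.2 _, h1⟩
  have heq := Submodule.eq_of_le_of_finrank_le hle (Submodule.finrank_map_le _ _)
  rw [heq]
  exact ⟨a, ha, rfl⟩

/-- The modular automorphism preserves finite-dimensional `*`-invariant subcoalgebras. -/
theorem modularMap_comul_mem (hh : IsPositiveHaarIntegral h) {C : Submodule ℂ A}
    [FiniteDimensional ℂ C] (hC : IsSliceStable C) (hstar : ∀ x ∈ C, star x ∈ C) {a : A}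
    (ha : a ∈ C) : modularMap h (comul (R := ℂ) a) ∈ C := by
  refine map_mem_of_mem_tensorSpan
    (mem_tensorSpan_of_sliceLeft (hC.left a ha)) (modularMap h) fun x _ y hy => ?_
  exact hC.left _ (hh.antipode_mem hC hstar (hh.antipode_mem hC hstar hy)) _

end IsPositiveHaarIntegral

/-! ### The coaction on forms and the projection onto invariant forms -/

namespace StarDifferentialCalculus

open Coalgebra HopfAlgebra

variable {A Ω : Type*} [Ring A] [StarRing A] [HopfAlgebra ℂ A] [Ring Ω] [Algebra ℂ Ω]
  (C : StarDifferentialCalculus A Ω)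

theorem eq_top_of_form_le {P : Submodule ℂ Ω} (hP : ∀ k, C.form k ≤ P) : P = ⊤ := by
  rw [eq_top_iff, ← C.isInternal.submodule_iSup_eq_top]
  exact iSup_le hP

theorem eq_of_eqOn_form {M : Type*} [AddCommGroup M] [Module ℂ M] {f g : Ω →ₗ[ℂ] M}
    (hfg : ∀ k, ∀ ω ∈ C.form k, f ω = g ω) (ω : Ω) : f ω = g ω := by
  have h : LinearMap.eqLocus f g = ⊤ := C.eq_top_of_form_le hfg
  have hω : ω ∈ LinearMap.eqLocus f g := h ▸ trivial
  exact hω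

theorem exists_incl_eq {ω : Ω} (hω : ω ∈ C.form 0) : ∃ a, C.incl a = ω := by
  rw [← C.range_incl] at hω
  exact hω

theorem one_mem_form : (1 : Ω) ∈ C.form 0 := by
  rw [← map_one C.incl]
  exact C.incl_mem 1

theorem incl_mul_mem (a : A) {k : ℕ} {ω : Ω} (hω : ω ∈ C.form k) :
    C.incl a * ω ∈ C.form k := by
  have := C.mul_mem (C.incl_mem a) hω
  rwa [zero_add] at this

theorem subalgebra_eq_top {P : Subalgebra ℂ Ω} (h0 : ∀ a, C.incl a ∈ P)
    (h1 : ∀ a, C.d (C.incl a) ∈ P) : P = ⊤ := by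
  rw [← Algebra.toSubmodule_eq_top]
  refine C.eq_top_of_form_le fun k => ?_
  rcases Nat.eq_zero_or_pos k with rfl | hk
  · intro ω hω
    obtain ⟨a, rfl⟩ := C.exists_incl_eq hω
    exact h0 a
  · rw [C.form_eq_span k hk, Submodule.span_le]
    rintro _ ⟨a₀, a, rfl⟩
    refine P.mul_mem (h0 a₀) (P.list_prod_mem fun x hx => ?_)
    obtain ⟨i, rfl⟩ := List.mem_ofFn.1 hx
    exact h1 _

/-- The coaction axioms are equalities between algebra homomorphisms, and these are verified on the
generators `a` and `da`, where they reduce to the axioms of the coalgebra `A`. -/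
theorem isLeftCoaction : IsLeftCoaction C.coact.toLinearMap := by
  have hgen : ∀ f : A →ₗ[ℂ] Ω, (∀ a, C.coact (f a) = f.lTensor A (comul (R := ℂ) a)) → ∀ a,
      TensorProduct.assoc ℂ A A Ω ((comul (R := ℂ) (A := A)).rTensor Ω (C.coact (f a))) =
        C.coact.toLinearMap.lTensor A (C.coact (f a)) ∧
      (counit (R := ℂ) (A := A)).rTensor Ω (C.coact (f a)) = 1 ⊗ₜ f a := by
    intro f hf a
    have h1 : ∀ t : A ⊗[ℂ] A, TensorProduct.assoc ℂ A A Ω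
        ((comul (R := ℂ) (A := A)).rTensor Ω (f.lTensor A t)) =
        (f.lTensor A).lTensor A
          (TensorProduct.assoc ℂ A A A ((comul (R := ℂ) (A := A)).rTensor A t)) := by
      intro t
      induction t with
      | zero => simp
      | add u v hu hv => simp only [map_add, hu, hv]
      | tmul b c =>
        simp only [LinearMap.lTensor_tmul, LinearMap.rTensor_tmul]
        induction comul (R := ℂ) b with
        | zero => simp
        | add u v hu hv => simp only [map_add, TensorProduct.add_tmul, hu, hv]
        | tmul b' c' => simp
    have h2 : ∀ t : A ⊗[ℂ] A, C.coact.toLinearMap.lTensor A (f.lTensor A t) =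
        (f.lTensor A).lTensor A ((comul (R := ℂ) (A := A)).lTensor A t) := by
      intro t
      induction t with
      | zero => simp
      | add u v hu hv => simp only [map_add, hu, hv]
      | tmul b c => simp [hf]
    have h3 : ∀ t : A ⊗[ℂ] A, (counit (R := ℂ) (A := A)).rTensor Ω (f.lTensor A t) =
        f.lTensor ℂ ((counit (R := ℂ) (A := A)).rTensor A t) := by
      intro t
      induction t with
      | zero => simp
      | add u v hu hv => simp only [map_add, hu, hv]
      | tmul b c => simp
    constructor
    · rw [hf, h1, h2, coassoc_apply]
    · rw [hf, h3, rTensor_counit_comul, LinearMap.lTensor_tmul]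
  have hincl : ∀ a, C.coact (C.incl.toLinearMap a) =
      C.incl.toLinearMap.lTensor A (comul (R := ℂ) a) := C.coact_incl
  have hd : ∀ a, C.coact ((C.d ∘ₗ C.incl.toLinearMap) a) =
      (C.d ∘ₗ C.incl.toLinearMap).lTensor A (comul (R := ℂ) a) := fun a => by
    rw [LinearMap.comp_apply, C.coact_d, hincl, LinearMap.lTensor_comp, LinearMap.comp_apply]
  let assocHom : (A ⊗[ℂ] A) ⊗[ℂ] Ω →ₐ[ℂ] A ⊗[ℂ] (A ⊗[ℂ] Ω) :=
    (Algebra.TensorProduct.assoc ℂ ℂ ℂ A A Ω : (A ⊗[ℂ] A) ⊗[ℂ] Ω →ₐ[ℂ] A ⊗[ℂ] (A ⊗[ℂ] Ω))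
  let L : Ω →ₐ[ℂ] A ⊗[ℂ] (A ⊗[ℂ] Ω) := assocHom.comp
    ((Algebra.TensorProduct.map (Bialgebra.comulAlgHom ℂ A) (AlgHom.id ℂ Ω)).comp C.coact)
  let R : Ω →ₐ[ℂ] A ⊗[ℂ] (A ⊗[ℂ] Ω) :=
    (Algebra.TensorProduct.map (AlgHom.id ℂ A) C.coact).comp C.coact
  let E : Ω →ₐ[ℂ] ℂ ⊗[ℂ] Ω :=
    (Algebra.TensorProduct.map (Bialgebra.counitAlgHom ℂ A) (AlgHom.id ℂ Ω)).comp C.coact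
  let F : Ω →ₐ[ℂ] ℂ ⊗[ℂ] Ω := Algebra.TensorProduct.includeRight
  have hLR : AlgHom.equalizer L R = ⊤ :=
    C.subalgebra_eq_top (fun a => (hgen _ hincl a).1) (fun a => (hgen _ hd a).1)
  have hEF : AlgHom.equalizer E F = ⊤ :=
    C.subalgebra_eq_top (fun a => (hgen _ hincl a).2) (fun a => (hgen _ hd a).2)
  refine ⟨fun x => ?_, fun x => ?_⟩
  · have : x ∈ AlgHom.equalizer L R := hLR ▸ trivial
    exact this
  · have : x ∈ AlgHom.equalizer E F := hEF ▸ trivial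
    exact this

theorem mul_mem_tensorSpan {k l : ℕ} {s t : A ⊗[ℂ] Ω} (hs : s ∈ tensorSpan ⊤ (C.form k))
    (ht : t ∈ tensorSpan ⊤ (C.form l)) : s * t ∈ tensorSpan ⊤ (C.form (k + l)) := by
  refine map_mem_of_mem_tensorSpan hs (LinearMap.mulRight ℂ t) fun x _ y hy => ?_
  refine map_mem_of_mem_tensorSpan ht (LinearMap.mulLeft ℂ (x ⊗ₜ y)) fun x' _ y' hy' => ?_
  rw [LinearMap.mulLeft_apply, Algebra.TensorProduct.tmul_mul_tmul]
  exact Submodule.apply_mem_map₂ _ trivial (C.mul_mem hy hy')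

theorem coact_mem {k : ℕ} {ω : Ω} (hω : ω ∈ C.form k) :
    C.coact ω ∈ tensorSpan ⊤ (C.form k) := by
  have h0 : ∀ a, C.coact (C.incl a) ∈ tensorSpan ⊤ (C.form 0) := fun a => by
    rw [C.coact_incl]
    induction comul (R := ℂ) a with
    | zero => simp
    | add u v hu hv => rw [map_add]; exact Submodule.add_mem _ hu hv
    | tmul b c => exact Submodule.apply_mem_map₂ _ trivial (C.incl_mem c)
  have h1 : ∀ a, C.coact (C.d (C.incl a)) ∈ tensorSpan ⊤ (C.form 1) := fun a => by
    rw [C.coact_d]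
    refine map_mem_of_mem_tensorSpan (h0 a) (C.d.lTensor A) fun x _ y hy => ?_
    exact Submodule.apply_mem_map₂ _ trivial (C.d_mem hy)
  have hprod : ∀ l : List Ω, (∀ x ∈ l, C.coact x ∈ tensorSpan ⊤ (C.form 1)) →
      C.coact l.prod ∈ tensorSpan ⊤ (C.form l.length) := by
    intro l
    induction l with
    | nil =>
      intro _
      have := h0 1
      rwa [map_one] at this
    | cons x l ih =>
      intro hx
      rw [List.prod_cons, map_mul, List.length_cons, add_comm]
      exact C.mul_mem_tensorSpan (hx x (by simp)) (ih fun y hy => hx y (by simp [hy]))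
  rcases Nat.eq_zero_or_pos k with rfl | hk
  · obtain ⟨a, rfl⟩ := C.exists_incl_eq hω
    exact h0 a
  · rw [C.form_eq_span k hk] at hω
    have hle : Submodule.span ℂ {ω : Ω | ∃ (a₀ : A) (a : Fin k → A),
        ω = C.incl a₀ * (List.ofFn fun i => C.d (C.incl (a i))).prod} ≤
        (tensorSpan ⊤ (C.form k)).comap C.coact.toLinearMap := by
      rw [Submodule.span_le]
      rintro _ ⟨a₀, a, rfl⟩
      rw [SetLike.mem_coe, Submodule.mem_comap, AlgHom.toLinearMap_apply, map_mul]
      have h2 := C.mul_mem_tensorSpan (h0 a₀)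
        (hprod (List.ofFn fun i => C.d (C.incl (a i))) fun x hx => by
          obtain ⟨i, rfl⟩ := List.mem_ofFn.1 hx
          exact h1 _)
      rwa [List.length_ofFn, zero_add] at h2
    exact hle hω

/-- The projection `ω ↦ S(ω₁) ω₂` of the forms onto the left-invariant forms. -/
noncomputable def projInv : Ω →ₗ[ℂ] Ω :=
  convAlong C.coact.toLinearMap (C.incl.toLinearMap ∘ₗ antipode ℂ) LinearMap.id

theorem convAlong_projInv :
    convAlong C.coact.toLinearMap C.incl.toLinearMap C.projInv = LinearMap.id :=
  convAlong_antipode_cancel_right C.isLeftCoaction C.incl LinearMap.id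

theorem mem_inv {ω : Ω} : ω ∈ C.inv ↔ C.coact ω = 1 ⊗ₜ ω := Iff.rfl

/-- Both `ω ↦ δ(π(ω))` and `ω ↦ 1 ⊗ π(ω)` become the coaction `δ` after convolution with
`a ↦ δ(a)`, and this convolution can be cancelled. -/
theorem projInv_mem_inv (ω : Ω) : C.projInv ω ∈ C.inv := by
  have hcancel := convAlong_antipode_cancel_left C.isLeftCoaction (C.coact.comp C.incl)
  let iR : Ω →ₐ[ℂ] A ⊗[ℂ] Ω := Algebra.TensorProduct.includeRight
  have h1 : convAlong C.coact.toLinearMap (C.coact.comp C.incl).toLinearMap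
      (C.coact.toLinearMap ∘ₗ C.projInv) = C.coact.toLinearMap := by
    have := algHom_comp_convAlong (δ := C.coact.toLinearMap) C.coact C.incl.toLinearMap C.projInv
    rw [convAlong_projInv, LinearMap.comp_id] at this
    exact this.symm
  have h2 : convAlong C.coact.toLinearMap (C.coact.comp C.incl).toLinearMap
      (iR.toLinearMap ∘ₗ C.projInv) = C.coact.toLinearMap := by
    have e : (C.coact.comp C.incl).toLinearMap = convAlong (comul (R := ℂ))
        (Algebra.TensorProduct.includeLeft : A →ₐ[ℂ] A ⊗[ℂ] Ω).toLinearMap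
        (iR.toLinearMap ∘ₗ C.incl.toLinearMap) := by
      ext a
      change C.coact (C.incl a) = _
      rw [C.coact_incl]
      simp only [convAlong, LinearMap.comp_apply]
      induction comul (R := ℂ) a with
      | zero => simp
      | add u v hu hv => simp only [map_add, hu, hv]
      | tmul b c => simp [iR]
    rw [e, ← convAlong_convAlong C.isLeftCoaction, ← algHom_comp_convAlong, convAlong_projInv,
      LinearMap.comp_id]
    exact convAlong_includeLeft_includeRight _
  have h3 := (hcancel _).symm.trans ((congrArg _ (h1.trans h2.symm)).trans (hcancel _))
  exact LinearMap.congr_fun h3 ω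

theorem coact_incl_mul {v : Ω} (hv : v ∈ C.inv) (a : A) : C.coact (C.incl a * v) =
    ((LinearMap.mulRight ℂ v ∘ₗ C.incl.toLinearMap).lTensor A) (comul (R := ℂ) a) := by
  rw [map_mul, C.coact_incl, C.mem_inv.1 hv]
  induction comul (R := ℂ) a with
  | zero => simp
  | add u v hu hv => simp only [map_add, add_mul, hu, hv]
  | tmul b c => simp

theorem projInv_incl_mul {v : Ω} (hv : v ∈ C.inv) (a : A) :
    C.projInv (C.incl a * v) = counit (R := ℂ) a • v := by
  have h := LinearMap.congr_fun (conv_antipode_left C.incl) a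
  simp only [convAlong, LinearMap.comp_apply, Algebra.linearMap_apply] at h
  rw [Algebra.smul_def, ← h, projInv, convAlong, LinearMap.comp_apply, LinearMap.comp_apply,
    AlgHom.toLinearMap_apply, C.coact_incl_mul hv]
  induction comul (R := ℂ) a with
  | zero => simp
  | add u v hu hv => simp only [map_add, add_mul, hu, hv]
  | tmul b c => simp [mul_assoc]

theorem projInv_mem_form {k : ℕ} {ω : Ω} (hω : ω ∈ C.form k) : C.projInv ω ∈ C.form k := by
  refine map_mem_of_mem_tensorSpan (C.coact_mem hω) (LinearMap.mul' ℂ Ω ∘ₗ TensorProduct.map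
    (C.incl.toLinearMap ∘ₗ antipode ℂ) LinearMap.id) fun x _ y hy => ?_
  simpa using C.incl_mul_mem _ hy

theorem projInv_mem_invForm {k : ℕ} {ω : Ω} (hω : ω ∈ C.form k) : C.projInv ω ∈ C.invForm k :=
  ⟨C.projInv_mem_form hω, C.projInv_mem_inv ω⟩

theorem projInv_eq_self {ω : Ω} (hω : ω ∈ C.inv) : C.projInv ω = ω := by
  have := C.projInv_incl_mul hω 1
  simpa using this

/-- `Ω_k` is generated by the invariant `k`-forms as a left `A`-module. -/
theorem mem_of_incl_mul_invForm_mem {k : ℕ} {P : Submodule ℂ Ω}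
    (hP : ∀ a : A, ∀ v ∈ C.invForm k, C.incl a * v ∈ P) {ω : Ω} (hω : ω ∈ C.form k) : ω ∈ P := by
  have h := LinearMap.congr_fun C.convAlong_projInv ω
  rw [LinearMap.id_apply] at h
  rw [← h]
  refine map_mem_of_mem_tensorSpan (C.coact_mem hω) (LinearMap.mul' ℂ Ω ∘ₗ TensorProduct.map
    C.incl.toLinearMap C.projInv) fun x _ y hy => ?_
  simpa using hP x _ (C.projInv_mem_invForm hy)

/-- The invariant forms are spanned by the homogeneous ones. -/
theorem inv_le_of_invForm_le {P : Submodule ℂ Ω} (hP : ∀ k, C.invForm k ≤ P) : C.inv ≤ P := by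
  have h : P.comap C.projInv = ⊤ := C.eq_top_of_form_le fun k ω hω =>
    hP k (C.projInv_mem_invForm hω)
  intro ω hω
  have h1 : ω ∈ P.comap C.projInv := h ▸ trivial
  rwa [Submodule.mem_comap, C.projInv_eq_self hω] at h1

/-- The inverse `ω ↦ ω₁ ⊗ S(ω₂) ω₃` of the isomorphism `A ⊗ Ω^inv ≅ Ω`, `a ⊗ v ↦ av`. -/
noncomputable def toTensor : Ω →ₗ[ℂ] A ⊗[ℂ] Ω := C.projInv.lTensor A ∘ₗ C.coact.toLinearMap

theorem toTensor_incl_mul {v : Ω} (hv : v ∈ C.inv) (a : A) :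
    C.toTensor (C.incl a * v) = a ⊗ₜ v := by
  have h1 : ∀ t : A ⊗[ℂ] A, C.projInv.lTensor A
      ((LinearMap.mulRight ℂ v ∘ₗ C.incl.toLinearMap).lTensor A t) =
      (sliceRight (counit (R := ℂ)) t) ⊗ₜ v := by
    intro t
    induction t with
    | zero => simp
    | add u v hu hv => simp only [map_add, TensorProduct.add_tmul, hu, hv]
    | tmul b c => simp [C.projInv_incl_mul hv, TensorProduct.smul_tmul]
  rw [toTensor, LinearMap.comp_apply, AlgHom.toLinearMap_apply, C.coact_incl_mul hv, h1,
    sliceRight_counit_comul]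

end StarDifferentialCalculus

/-! ### Homogeneous components -/

namespace StarDifferentialCalculus

open Coalgebra HopfAlgebra

variable {A Ω : Type*} [Ring A] [StarRing A] [HopfAlgebra ℂ A] [Ring Ω] [Algebra ℂ Ω]
  (C : StarDifferentialCalculus A Ω)

/-- The projection of the forms onto the `k`-forms. -/
noncomputable def formProj (k : ℕ) : Ω →ₗ[ℂ] Ω :=
  (C.form k).subtype ∘ₗ DirectSum.component ℂ ℕ (fun i => C.form i) k ∘ₗ
    (LinearEquiv.ofBijective (DirectSum.coeLinearMap C.form) C.isInternal).symm.toLinearMap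

theorem formProj_mem (k : ℕ) (ω : Ω) : C.formProj k ω ∈ C.form k := by
  simp [formProj]

theorem ofBijective_symm_apply {j : ℕ} {ω : Ω} (hω : ω ∈ C.form j) :
    (LinearEquiv.ofBijective (DirectSum.coeLinearMap C.form) C.isInternal).symm ω =
      DirectSum.lof ℂ ℕ (fun i => C.form i) j ⟨ω, hω⟩ := by
  rw [LinearEquiv.symm_apply_eq]
  change ω = DirectSum.coeLinearMap C.form _
  rw [DirectSum.coeLinearMap_lof]

theorem formProj_of_mem {k : ℕ} {ω : Ω} (hω : ω ∈ C.form k) : C.formProj k ω = ω := by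
  simp only [formProj, LinearMap.comp_apply, LinearEquiv.coe_coe, C.ofBijective_symm_apply hω]
  simp [DirectSum.component.lof_self]

theorem formProj_of_mem_ne {j k : ℕ} (hjk : j ≠ k) {ω : Ω} (hω : ω ∈ C.form j) :
    C.formProj k ω = 0 := by
  simp only [formProj, LinearMap.comp_apply, LinearEquiv.coe_coe, C.ofBijective_symm_apply hω]
  rw [DirectSum.component.of, dif_neg hjk]
  simp

variable {C} {N : ℕ}

theorem HasDimension.eq_zero (hN : C.HasDimension N) {k : ℕ} (hk : N < k) {ω : Ω}
    (hω : ω ∈ C.form k) : ω = 0 := by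
  rw [hN.2 k hk] at hω
  exact hω

theorem HasDimension.sum_formProj (hN : C.HasDimension N) (ω : Ω) :
    ∑ k ∈ Finset.range (N + 1), C.formProj k ω = ω := by
  have h : ∀ ω₀, (∑ k ∈ Finset.range (N + 1), C.formProj k) ω₀ =
        (LinearMap.id : Ω →ₗ[ℂ] Ω) ω₀ := by
    refine C.eq_of_eqOn_form fun j η hη => ?_
    rw [LinearMap.sum_apply, LinearMap.id_apply]
    rcases le_or_gt j N with hj | hj
    · rw [Finset.sum_eq_single j, C.formProj_of_mem hη]
      · intro k _ hk
        exact C.formProj_of_mem_ne hk.symm hη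
      · intro hj'
        exact absurd (Finset.mem_range.2 (Nat.lt_succ_of_le hj)) hj'
    · rw [hN.eq_zero hj hη]
      simp
  have h1 := h ω
  rwa [LinearMap.sum_apply, LinearMap.id_apply] at h1

/-! ### The integral -/

variable {h : A →ₗ[ℂ] ℂ} {θ : Ω} {I : Ω →ₗ[ℂ] ℂ}

theorem IsVolumeElement.exists_dual_ne_zero (hθ : C.IsVolumeElement N θ) :
    ∃ f : Ω →ₗ[ℂ] ℂ, f θ ≠ 0 := by
  by_contra! hcon
  exact hθ.ne_zero ((Module.forall_dual_apply_eq_zero_iff ℂ θ).1 hcon)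

/-- `Ω_N` is generated by the volume element as a left `A`-module. -/
theorem exists_incl_mul_eq (hdim : Module.finrank ℂ (C.invForm N) = 1)
    (hθ : C.IsVolumeElement N θ) {ω : Ω} (hω : ω ∈ C.form N) : ∃ a, C.incl a * θ = ω := by
  have hmem := C.mem_of_incl_mul_invForm_mem (k := N)
    (P := LinearMap.range (LinearMap.mulRight ℂ θ ∘ₗ C.incl.toLinearMap)) ?_ hω
  · obtain ⟨a, ha⟩ := hmem
    exact ⟨a, ha⟩
  · intro a v hv
    obtain ⟨c, hc⟩ := (finrank_eq_one_iff_of_nonzero' (⟨θ, hθ.mem⟩ : C.invForm N)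
      (fun h0 => hθ.ne_zero (congrArg Subtype.val h0))).1 hdim ⟨v, hv⟩
    refine ⟨c • a, ?_⟩
    have hc' : c • θ = v := congrArg Subtype.val hc
    simp [← hc']

theorem exists_isIntegral (h : A →ₗ[ℂ] ℂ) (hθ : C.IsVolumeElement N θ) :
    ∃ I : Ω →ₗ[ℂ] ℂ, C.IsIntegral h N θ I := by
  obtain ⟨f, hf⟩ := hθ.exists_dual_ne_zero
  refine ⟨(f θ)⁻¹ • (h ∘ₗ sliceRight f ∘ₗ C.toTensor ∘ₗ C.formProj N), ?_, ?_⟩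
  · intro k hk ω hω
    simp [C.formProj_of_mem_ne hk.ne hω]
  · intro a
    simp [C.formProj_of_mem (C.incl_mul_mem a hθ.mem.1), C.toTensor_incl_mul hθ.mem.2, hf]

theorem IsIntegral.unique (hN : C.HasDimension N) (hdim : Module.finrank ℂ (C.invForm N) = 1)
    (hθ : C.IsVolumeElement N θ) {I J : Ω →ₗ[ℂ] ℂ} (hI : C.IsIntegral h N θ I)
    (hJ : C.IsIntegral h N θ J) : I = J := by
  refine LinearMap.ext (C.eq_of_eqOn_form fun k ω hω => ?_)
  rcases lt_trichotomy k N with hk | rfl | hk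
  · rw [hI.of_lt k hk ω hω, hJ.of_lt k hk ω hω]
  · obtain ⟨a, rfl⟩ := exists_incl_mul_eq hdim hθ hω
    rw [hI.top, hJ.top]
  · rw [hN.eq_zero hk hω, map_zero, map_zero]

theorem IsIntegral.eq_zero_of_ne (hN : C.HasDimension N) (hI : C.IsIntegral h N θ I) {k : ℕ}
    (hk : k ≠ N) {ω : Ω} (hω : ω ∈ C.form k) : I ω = 0 := by
  rcases lt_or_gt_of_ne hk with hk | hk
  · exact hI.of_lt k hk ω hω
  · rw [hN.eq_zero hk hω, map_zero]

/-- The integral is invariant for the coaction on forms. -/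
theorem IsIntegral.isInvariantFunctional (hh : IsPositiveHaarIntegral h)
    (hN : C.HasDimension N) (hdim : Module.finrank ℂ (C.invForm N) = 1)
    (hθ : C.IsVolumeElement N θ) (hI : C.IsIntegral h N θ I) :
    IsInvariantFunctional C.coact.toLinearMap I := by
  have key : ∀ ω₀, (sliceRight I ∘ₗ C.coact.toLinearMap) ω₀ =
        (LinearMap.toSpanSingleton ℂ A 1 ∘ₗ I) ω₀ := by
    refine C.eq_of_eqOn_form fun k ω hω => ?_
    by_cases hk : k = N
    · subst hk
      obtain ⟨a, rfl⟩ := exists_incl_mul_eq hdim hθ hω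
      simp only [LinearMap.comp_apply, AlgHom.toLinearMap_apply, C.coact_incl_mul hθ.mem.2, hI.top,
        LinearMap.toSpanSingleton_apply]
      rw [← hh.isInvariantFunctional]
      change _ = sliceRight h (comul (R := ℂ) a)
      induction comul (R := ℂ) a with
      | zero => simp
      | add u v hu hv => simp only [map_add, hu, hv]
      | tmul b c => simp [hI.top]
    · have h1 := map_mem_of_mem_tensorSpan (C.coact_mem hω) (sliceRight I) (E := ⊥)
        (fun x _ y hy => by simp [hI.eq_zero_of_ne hN hk hy])
      rw [LinearMap.comp_apply, LinearMap.comp_apply, hI.eq_zero_of_ne hN hk hω, map_zero]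
      exact h1
  intro ω
  exact key ω

/-- The integral is closed. By invariance `∫ d(av) = h(a) ∫ dv` for an invariant form `v`. -/
theorem IsIntegral.map_d (hh : IsPositiveHaarIntegral h)
    (hN : C.HasDimension N) (hdim : Module.finrank ℂ (C.invForm N) = 1)
    (hclosed : ∀ k, k + 1 = N → ∀ ω ∈ C.invForm k, C.d ω = 0)
    (hθ : C.IsVolumeElement N θ) (hI : C.IsIntegral h N θ I) (ω : Ω) : I (C.d ω) = 0 := by
  have key : ∀ ω₀, (I ∘ₗ C.d) ω₀ = (0 : Ω →ₗ[ℂ] ℂ) ω₀ := by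
    refine C.eq_of_eqOn_form fun k ω hω => ?_
    by_cases hk : k + 1 = N
    · refine C.mem_of_incl_mul_invForm_mem (P := LinearMap.ker (I ∘ₗ C.d)) (fun a v hv => ?_) hω
      rw [LinearMap.mem_ker, LinearMap.comp_apply]
      have h1 := hI.isInvariantFunctional hh hN hdim hθ (C.d (C.incl a * v))
      have h2 := congrArg h h1
      rw [AlgHom.toLinearMap_apply, C.coact_d, C.coact_incl_mul hv.2, map_smul, hh.map_one,
        smul_eq_mul, mul_one] at h2
      have h3 : ∀ t : A ⊗[ℂ] A, h (sliceRight I (C.d.lTensor A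
          ((LinearMap.mulRight ℂ v ∘ₗ C.incl.toLinearMap).lTensor A t))) =
          I (C.d (C.incl (sliceLeft h t) * v)) := by
        intro t
        induction t with
        | zero => simp
        | add u v hu hv => simp only [map_add, add_mul, hu, hv]
        | tmul b c => simp [mul_comm]
      rw [← h2, h3, hh.slice_left]
      simp [hclosed k hk v hv]
    · exact hI.eq_zero_of_ne hN hk (C.d_mem hω)
  exact key ω

/-! ### Nondegeneracy of the integral -/

/-- `aθ = θb` for a suitable `b`, since `(bθ)* = θb*`. -/
theorem exists_mul_incl_eq (hdim : Module.finrank ℂ (C.invForm N) = 1)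
    (hθ : C.IsVolumeElement N θ) (a : A) : ∃ b, θ * C.incl b = C.incl a * θ := by
  have e : ∀ b, C.invol (C.incl b * θ) = θ * C.incl (star b) := fun b => by
    rw [C.invol_mul (C.incl_mem b) hθ.mem.1, hθ.selfAdjoint, C.incl_star]
    simp
  obtain ⟨b, hb⟩ := exists_incl_mul_eq hdim hθ
    (C.invol_mem (C.incl_mul_mem a hθ.mem.1))
  refine ⟨star b, ?_⟩
  rw [← e, hb, C.invol_invol]

theorem exists_incl_mul_eq_mul_incl (hdim : Module.finrank ℂ (C.invForm N) = 1)
    (hθ : C.IsVolumeElement N θ) (b : A) : ∃ a, C.incl a * θ = θ * C.incl b := by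
  have := C.mul_mem hθ.mem.1 (C.incl_mem b)
  exact exists_incl_mul_eq hdim hθ this

/-- If `ω'ω = bθ`, then `h(ab) = ∫ aω'ω` vanishes for all `a`, so that `b = 0`. -/
theorem IsIntegral.eq_zero_of_forall_mul_left (hh : IsPositiveHaarIntegral h)
    (hN : C.HasDimension N) (hdim : Module.finrank ℂ (C.invForm N) = 1)
    (hnondeg : C.Nondegenerate N) (hθ : C.IsVolumeElement N θ) (hI : C.IsIntegral h N θ I)
    {ω : Ω} (hω : ∀ ω', I (ω' * ω) = 0) : ω = 0 := by
  rw [← hN.sum_formProj ω]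
  refine Finset.sum_eq_zero fun k hk => ?_
  have hk' : k ≤ N := Nat.lt_succ_iff.1 (Finset.mem_range.1 hk)
  refine hnondeg k hk' _ (C.formProj_mem k ω) fun ω' hω' => ?_
  have hmem : ω' * C.formProj k ω ∈ C.form N := by
    have := C.mul_mem hω' (C.formProj_mem k ω)
    rwa [Nat.sub_add_cancel hk'] at this
  obtain ⟨b, hb⟩ := exists_incl_mul_eq hdim hθ hmem
  rw [← hb, hh.eq_zero_of_forall_mul_left (a := b), map_zero, zero_mul]
  intro a
  have h1 := hω (C.incl a * ω')
  rw [← hN.sum_formProj ω, Finset.mul_sum, map_sum, Finset.sum_eq_single k] at h1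
  · rwa [mul_assoc, ← hb, ← mul_assoc, ← map_mul, hI.top] at h1
  · intro j _ hj
    exact hI.eq_zero_of_ne hN (by omega) (C.mul_mem (C.incl_mul_mem a hω') (C.formProj_mem j ω))
  · intro h0
    exact absurd hk h0

/-- Nondegeneracy on the other side, by means of the involution. -/
theorem eq_zero_of_forall_mul_right (hnondeg : C.Nondegenerate N) {k : ℕ} (hk : k ≤ N) {ω : Ω}
    (hω : ω ∈ C.form k) (h0 : ∀ ω' ∈ C.form (N - k), ω * ω' = 0) : ω = 0 := by
  rw [← C.invol_invol ω, hnondeg k hk (C.invol ω) (C.invol_mem hω), map_zero]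
  intro ω' hω'
  have h1 := C.invol_mul hω (C.invol_mem hω')
  rw [h0 _ (C.invol_mem hω'), map_zero, C.invol_invol] at h1
  exact (smul_eq_zero.1 h1.symm).resolve_left (pow_ne_zero _ (by norm_num))

/-- If `ωω' = bθ`, then `h(ba) = ∫ baθ = ∫ ωω'c` with `aθ = θc` vanishes for all `a`. -/
theorem IsIntegral.eq_zero_of_forall_mul_right (hh : IsPositiveHaarIntegral h)
    (hN : C.HasDimension N) (hdim : Module.finrank ℂ (C.invForm N) = 1)
    (hnondeg : C.Nondegenerate N) (hθ : C.IsVolumeElement N θ) (hI : C.IsIntegral h N θ I)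
    [StarModule ℂ A] {ω : Ω} (hω : ∀ ω', I (ω * ω') = 0) : ω = 0 := by
  rw [← hN.sum_formProj ω]
  refine Finset.sum_eq_zero fun k hk => ?_
  have hk' : k ≤ N := Nat.lt_succ_iff.1 (Finset.mem_range.1 hk)
  refine StarDifferentialCalculus.eq_zero_of_forall_mul_right hnondeg hk' (C.formProj_mem k ω)
    fun ω' hω' => ?_
  have hmem : C.formProj k ω * ω' ∈ C.form N := by
    have := C.mul_mem (C.formProj_mem k ω) hω'
    rwa [Nat.add_sub_cancel' hk'] at this
  obtain ⟨b, hb⟩ := exists_incl_mul_eq hdim hθ hmem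
  rw [← hb, hh.eq_zero_of_forall_mul_right (a := b), map_zero, zero_mul]
  intro a
  obtain ⟨c, hc⟩ := exists_mul_incl_eq hdim hθ a
  have hω'' : ω' * C.incl c ∈ C.form (N - k) := C.mul_mem hω' (C.incl_mem c)
  have h1 := hω (ω' * C.incl c)
  rw [← hN.sum_formProj ω, Finset.sum_mul, map_sum, Finset.sum_eq_single k] at h1
  · rwa [← mul_assoc, ← hb, mul_assoc, hc, ← mul_assoc, ← map_mul, hI.top] at h1
  · intro j _ hj
    exact hI.eq_zero_of_ne hN (by omega) (C.mul_mem (C.formProj_mem j ω) hω'')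
  · intro h0
    exact absurd hk h0

end StarDifferentialCalculus

/-! ### The twist automorphism -/

/-- `η` represents the functional `I(· ω)` as `I(η ·)`. -/
def IsTwistPair {Ω : Type*} [Ring Ω] [Algebra ℂ Ω] (I : Ω →ₗ[ℂ] ℂ) (ω η : Ω) : Prop :=
  ∀ ω', I (ω' * ω) = I (η * ω')

namespace IsTwistPair

variable {Ω : Type*} [Ring Ω] [Algebra ℂ Ω] {I : Ω →ₗ[ℂ] ℂ} {ω₁ ω₂ η₁ η₂ : Ω}

theorem add (h₁ : IsTwistPair I ω₁ η₁) (h₂ : IsTwistPair I ω₂ η₂) :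
    IsTwistPair I (ω₁ + ω₂) (η₁ + η₂) := fun ω' => by
  rw [mul_add, add_mul, map_add, map_add, h₁, h₂]

theorem smul (c : ℂ) (h₁ : IsTwistPair I ω₁ η₁) : IsTwistPair I (c • ω₁) (c • η₁) :=
  fun ω' => by rw [mul_smul_comm, smul_mul_assoc, map_smul, map_smul, h₁]

theorem mul (h₁ : IsTwistPair I ω₁ η₁) (h₂ : IsTwistPair I ω₂ η₂) :
    IsTwistPair I (ω₁ * ω₂) (η₁ * η₂) := fun ω' => by
  rw [← mul_assoc, h₂, ← mul_assoc, h₁, mul_assoc]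

theorem algebraMap (I : Ω →ₗ[ℂ] ℂ) (c : ℂ) :
    IsTwistPair I (algebraMap ℂ Ω c) (algebraMap ℂ Ω c) := fun ω' => by
  rw [Algebra.commutes]

end IsTwistPair

namespace StarDifferentialCalculus

open Coalgebra HopfAlgebra

variable {A Ω : Type*} [Ring A] [StarRing A] [HopfAlgebra ℂ A] [Ring Ω] [Algebra ℂ Ω]
  {C : StarDifferentialCalculus A Ω} {N : ℕ} {h : A →ₗ[ℂ] ℂ} {θ : Ω} {I : Ω →ₗ[ℂ] ℂ}

/-- If `θb = aθ` and `h(· a) = h(c ·)`, then `b` and `c` form a twist pair. -/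
theorem IsIntegral.isTwistPair_incl (hN : C.HasDimension N)
    (hdim : Module.finrank ℂ (C.invForm N) = 1) (hθ : C.IsVolumeElement N θ)
    (hI : C.IsIntegral h N θ I) {a b c : A} (hab : C.incl a * θ = θ * C.incl b)
    (hac : ∀ x, h (x * a) = h (c * x)) : IsTwistPair I (C.incl b) (C.incl c) := by
  have key : ∀ ω₀, (I ∘ₗ LinearMap.mulRight ℂ (C.incl b)) ω₀ =
        (I ∘ₗ LinearMap.mulLeft ℂ (C.incl c)) ω₀ := by
    refine C.eq_of_eqOn_form fun k ω hω => ?_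
    change I (ω * C.incl b) = I (C.incl c * ω)
    by_cases hk : k = N
    · subst hk
      obtain ⟨x, rfl⟩ := exists_incl_mul_eq hdim hθ hω
      rw [mul_assoc, ← hab, ← mul_assoc, ← mul_assoc, ← map_mul, ← map_mul, hI.top, hI.top, hac]
    · rw [hI.eq_zero_of_ne hN hk (C.mul_mem hω (C.incl_mem b)),
        hI.eq_zero_of_ne hN hk (C.incl_mul_mem c hω)]
  intro ω
  exact key ω

/-- Twist pairs are compatible with the differential, up to a sign: integrate by parts on both
sides, using that the integral is closed. -/
theorem IsIntegral.isTwistPair_d (hN : C.HasDimension N) (hI : C.IsIntegral h N θ I)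
    (hId : ∀ ω, I (C.d ω) = 0) {l : ℕ} {ω η : Ω} (hω : ω ∈ C.form l) (hη : η ∈ C.form l)
    (hp : IsTwistPair I ω η) : IsTwistPair I (C.d ω) ((-1 : ℂ) ^ (N + 1) • C.d η) := by
  have key : ∀ ω₀, (I ∘ₗ LinearMap.mulRight ℂ (C.d ω)) ω₀ =
        (I ∘ₗ LinearMap.mulLeft ℂ ((-1 : ℂ) ^ (N + 1) • C.d η)) ω₀ := by
    refine C.eq_of_eqOn_form fun j ω' hω' => ?_
    change I (ω' * C.d ω) = I (((-1 : ℂ) ^ (N + 1) • C.d η) * ω')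
    rw [smul_mul_assoc, map_smul, smul_eq_mul]
    by_cases hjl : j + (l + 1) = N
    · have h1 := congrArg I (C.d_mul hω' ω)
      have h2 := congrArg I (C.d_mul hη ω')
      rw [hId, map_add, map_smul, smul_eq_mul] at h1 h2
      rw [hp] at h1
      have hj : ((-1 : ℂ) ^ j) * (-1) ^ j = 1 := by rw [← mul_pow]; norm_num
      have hl : ((-1 : ℂ) ^ l) * (-1) ^ l = 1 := by rw [← mul_pow]; norm_num
      have e : (-1 : ℂ) ^ (N + 1) = (-1) ^ j * (-1) ^ l := by
        rw [← hjl]; ring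
      rw [e]
      linear_combination (-(-1 : ℂ) ^ j) * h1 + (-1 : ℂ) ^ j * (-1 : ℂ) ^ l * h2 -
        I (ω' * C.d ω) * hj + (-1 : ℂ) ^ j * I (η * C.d ω') * hl
    · rw [hI.eq_zero_of_ne hN hjl (C.mul_mem hω' (C.d_mem hω)),
        hI.eq_zero_of_ne hN (k := l + 1 + j) (by omega) (C.mul_mem (C.d_mem hη) hω'), mul_zero]
  intro ω'
  exact key ω'

variable [StarModule ℂ A]

/-- In a twist pair `(ω, η)` with `ω ∈ Ω_l`, each component of `η` of degree `j ≠ l` pairs to zero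
with `Ω_{N-j}`, so that `η ∈ Ω_l`. -/
theorem IsIntegral.twistPair_mem_form (hh : IsPositiveHaarIntegral h)
    (hN : C.HasDimension N) (hdim : Module.finrank ℂ (C.invForm N) = 1)
    (hnondeg : C.Nondegenerate N) (hθ : C.IsVolumeElement N θ) (hI : C.IsIntegral h N θ I)
    {ω η : Ω} (hp : IsTwistPair I ω η) {l : ℕ} (hω : ω ∈ C.form l) : η ∈ C.form l := by
  have h0 : ∀ j ≠ l, C.formProj j η = 0 := by
    intro j hjl
    rcases lt_or_ge N j with hj | hj
    · exact hN.eq_zero hj (C.formProj_mem j η)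
    refine StarDifferentialCalculus.eq_zero_of_forall_mul_right hnondeg hj (C.formProj_mem j η)
      fun ω' hω' => ?_
    have hmem : C.formProj j η * ω' ∈ C.form N := by
      have := C.mul_mem (C.formProj_mem j η) hω'
      rwa [Nat.add_sub_cancel' hj] at this
    obtain ⟨b, hb⟩ := exists_incl_mul_eq hdim hθ hmem
    rw [← hb, hh.eq_zero_of_forall_mul_right (a := b), map_zero, zero_mul]
    intro a
    obtain ⟨c, hc⟩ := exists_mul_incl_eq hdim hθ a
    have hω'' : ω' * C.incl c ∈ C.form (N - j) := C.mul_mem hω' (C.incl_mem c)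
    have h1 := hp (ω' * C.incl c)
    rw [hI.eq_zero_of_ne hN (k := N - j + l) (by omega) (C.mul_mem hω'' hω),
      ← hN.sum_formProj η, Finset.sum_mul, map_sum, Finset.sum_eq_single j] at h1
    · rw [← mul_assoc, ← hb, mul_assoc, hc, ← mul_assoc, ← map_mul, hI.top] at h1
      exact h1.symm
    · intro i _ hi
      exact hI.eq_zero_of_ne hN (by omega) (C.mul_mem (C.formProj_mem i η) hω'')
    · intro hj'
      exact absurd (Finset.mem_range.2 (Nat.lt_succ_of_le hj)) hj'
  rw [← hN.sum_formProj η]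
  refine Submodule.sum_mem _ fun j _ => ?_
  by_cases hj : j = l
  · exact hj ▸ C.formProj_mem j η
  · rw [h0 j hj]
    exact Submodule.zero_mem _

/-- The twist pairs form the graph of an algebra automorphism. Both projections of the graph are
subalgebras; they contain `A` because of the modular automorphism of `h` and `Aθ = θA`, and they
contain `dA` by integration by parts. -/
theorem IsIntegral.exists_algEquiv_isTwistPair (hh : IsPositiveHaarIntegral h)
    (hN : C.HasDimension N) (hdim : Module.finrank ℂ (C.invForm N) = 1)
    (hclosed : ∀ k, k + 1 = N → ∀ ω ∈ C.invForm k, C.d ω = 0)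
    (hnondeg : C.Nondegenerate N) (hθ : C.IsVolumeElement N θ) (hI : C.IsIntegral h N θ I) :
    ∃ τ : Ω ≃ₐ[ℂ] Ω, ∀ ω, IsTwistPair I ω (τ ω) := by
  have hId := hI.map_d hh hN hdim hclosed hθ
  let dom : Subalgebra ℂ Ω :=
    { carrier := {ω | ∃ η, IsTwistPair I ω η}
      mul_mem' := fun ⟨_, h₁⟩ ⟨_, h₂⟩ => ⟨_, h₁.mul h₂⟩
      add_mem' := fun ⟨_, h₁⟩ ⟨_, h₂⟩ => ⟨_, h₁.add h₂⟩
      algebraMap_mem' := fun c => ⟨_, IsTwistPair.algebraMap I c⟩ }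
  let ran : Subalgebra ℂ Ω :=
    { carrier := {η | ∃ ω, IsTwistPair I ω η}
      mul_mem' := fun ⟨_, h₁⟩ ⟨_, h₂⟩ => ⟨_, h₁.mul h₂⟩
      add_mem' := fun ⟨_, h₁⟩ ⟨_, h₂⟩ => ⟨_, h₁.add h₂⟩
      algebraMap_mem' := fun c => ⟨_, IsTwistPair.algebraMap I c⟩ }
  have hdom_incl : ∀ b, ∃ c, IsTwistPair I (C.incl b) (C.incl c) := by
    intro b
    obtain ⟨a, ha⟩ := exists_incl_mul_eq_mul_incl hdim hθ b
    exact ⟨_, hI.isTwistPair_incl hN hdim hθ ha (hh.mul_eq_modularMap_mul a)⟩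
  have hran_incl : ∀ c, ∃ b, IsTwistPair I (C.incl b) (C.incl c) := by
    intro c
    -- applying the involution to `h(x a) = h(σ_h(a) x)` shows that `σ_h` is surjective
    let a := star (IsPositiveHaarIntegral.modularMap h (comul (R := ℂ) (star c)))
    have ha : ∀ x, h (x * a) = h (c * x) := fun x => by
      have h1 := hh.mul_eq_modularMap_mul (star c) (star x)
      have h2 := congrArg (starRingEnd ℂ) h1
      rw [← hh.map_star, ← hh.map_star, star_mul, star_mul, star_star, star_star] at h2
      exact h2.symm
    obtain ⟨b, hb⟩ := exists_mul_incl_eq hdim hθ a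
    exact ⟨b, hI.isTwistPair_incl hN hdim hθ hb.symm ha⟩
  have hdom : dom = ⊤ := C.subalgebra_eq_top
    (fun a => let ⟨c, hc⟩ := hdom_incl a; ⟨_, hc⟩)
    (fun a => let ⟨c, hc⟩ := hdom_incl a
      ⟨_, hI.isTwistPair_d hN hId (C.incl_mem a) (C.incl_mem c) hc⟩)
  have hsign : (-1 : ℂ) ^ (N + 1) * (-1) ^ (N + 1) = 1 := by rw [← mul_pow]; norm_num
  have hran : ran = ⊤ := C.subalgebra_eq_top
    (fun c => let ⟨b, hb⟩ := hran_incl c; ⟨_, hb⟩)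
    (fun c => by
      obtain ⟨b, hb⟩ := hran_incl c
      refine ⟨(-1 : ℂ) ^ (N + 1) • C.d (C.incl b), ?_⟩
      have h1 := (hI.isTwistPair_d hN hId (C.incl_mem b) (C.incl_mem c) hb).smul
        ((-1 : ℂ) ^ (N + 1))
      rwa [smul_smul, hsign, one_smul] at h1)
  have huniq : ∀ {ω η η' : Ω}, IsTwistPair I ω η → IsTwistPair I ω η' → η = η' := by
    intro ω η η' h₁ h₂
    refine sub_eq_zero.1 (hI.eq_zero_of_forall_mul_right hh hN hdim hnondeg hθ fun ω' => ?_)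
    rw [sub_mul, map_sub, ← h₁, ← h₂, sub_self]
  have huniq' : ∀ {ω ω' η : Ω}, IsTwistPair I ω η → IsTwistPair I ω' η → ω = ω' := by
    intro ω ω₁ η h₁ h₂
    refine sub_eq_zero.1 (hI.eq_zero_of_forall_mul_left hh hN hdim hnondeg hθ fun ω' => ?_)
    rw [mul_sub, map_sub, h₁, h₂, sub_self]
  have hex : ∀ ω, ∃ η, IsTwistPair I ω η := fun ω => by
    have : ω ∈ dom := hdom ▸ trivial
    exact this
  choose f hf using hex
  let F : Ω →ₐ[ℂ] Ω := AlgHom.ofLinearMap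
    { toFun := f
      map_add' := fun x y => huniq (hf _) ((hf x).add (hf y))
      map_smul' := fun c x => huniq (hf _) ((hf x).smul c) }
    (huniq (hf _) (by simpa using IsTwistPair.algebraMap I 1))
    (fun x y => huniq (hf _) ((hf x).mul (hf y)))
  refine ⟨AlgEquiv.ofBijective F ⟨fun x y hxy => ?_, fun η => ?_⟩, hf⟩
  · have hxy' : f x = f y := hxy
    exact huniq' (hf x) (hxy' ▸ hf y)
  · have : η ∈ ran := hran ▸ trivial
    obtain ⟨ω, hω⟩ := this
    exact ⟨ω, huniq (hf ω) hω⟩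

omit [StarModule ℂ A] in
/-- Multiplication by `(-1)^{k(N+1)}` on the `k`-forms is an algebra automorphism. -/
theorem HasDimension.exists_signEquiv (hN : C.HasDimension N) :
    ∃ γ : Ω ≃ₐ[ℂ] Ω, ∀ k, ∀ ω ∈ C.form k, γ ω = (-1 : ℂ) ^ (k * (N + 1)) • ω := by
  let g : Ω →ₗ[ℂ] Ω := ∑ k ∈ Finset.range (N + 1), (-1 : ℂ) ^ (k * (N + 1)) • C.formProj k
  have hg : ∀ k, ∀ ω ∈ C.form k, g ω = (-1 : ℂ) ^ (k * (N + 1)) • ω := by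
    intro k ω hω
    rcases lt_or_ge N k with hk | hk
    · rw [hN.eq_zero hk hω]; simp
    · simp only [g, LinearMap.sum_apply, LinearMap.smul_apply]
      rw [Finset.sum_eq_single k, C.formProj_of_mem hω]
      · intro j _ hj
        rw [C.formProj_of_mem_ne hj.symm hω, smul_zero]
      · intro hk'
        exact absurd (Finset.mem_range.2 (Nat.lt_succ_of_le hk)) hk'
  have hgg : ∀ ω, g (g ω) = ω := by
    have key : ∀ ω₀, (g ∘ₗ g) ω₀ = (LinearMap.id : Ω →ₗ[ℂ] Ω) ω₀ := by
      refine C.eq_of_eqOn_form fun k ω hω => ?_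
      rw [LinearMap.comp_apply, hg k ω hω, map_smul, hg k ω hω, smul_smul,
        ← mul_pow]
      norm_num
    exact key
  have hmul : ∀ x y, g (x * y) = g x * g y := by
    have h1 : ∀ k, ∀ x ∈ C.form k, ∀ y, g (x * y) = g x * g y := by
      intro k x hx y
      have key : ∀ ω₀, (g ∘ₗ LinearMap.mulLeft ℂ x) ω₀ = (LinearMap.mulLeft ℂ (g x) ∘ₗ g) ω₀ := by
        refine C.eq_of_eqOn_form fun l y hy => ?_
        change g (x * y) = g x * g y
        rw [hg _ _ (C.mul_mem hx hy), hg k x hx, hg l y hy, smul_mul_smul_comm, ← pow_add,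
          add_mul]
      exact key y
    intro x y
    have key : ∀ ω₀, (g ∘ₗ LinearMap.mulRight ℂ y) ω₀ =
        (LinearMap.mulRight ℂ (g y) ∘ₗ g) ω₀ := C.eq_of_eqOn_form fun k x hx => h1 k x hx y
    exact key x
  let G : Ω →ₐ[ℂ] Ω := AlgHom.ofLinearMap g (by simpa using hg 0 1 C.one_mem_form) hmul
  exact ⟨AlgEquiv.ofAlgHom G G (AlgHom.ext hgg) (AlgHom.ext hgg), hg⟩

theorem IsTwistAutomorphism.unique (hh : IsPositiveHaarIntegral h)
    (hN : C.HasDimension N) (hdim : Module.finrank ℂ (C.invForm N) = 1)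
    (hnondeg : C.Nondegenerate N) (hθ : C.IsVolumeElement N θ) (hI : C.IsIntegral h N θ I)
    {σ τ : Ω ≃ₐ[ℂ] Ω} (hσ : C.IsTwistAutomorphism I σ) (hτ : C.IsTwistAutomorphism I τ) :
    σ = τ := by
  have key : ∀ ω₀, σ.toLinearMap ω₀ = τ.toLinearMap ω₀ := by
    refine C.eq_of_eqOn_form fun l ω hω => ?_
    refine sub_eq_zero.1 (hI.eq_zero_of_forall_mul_right hh hN hdim hnondeg hθ fun ω' => ?_)
    have key2 : ∀ y, (I ∘ₗ LinearMap.mulLeft ℂ (σ ω - τ ω)) y = (0 : Ω →ₗ[ℂ] ℂ) y := by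
      refine C.eq_of_eqOn_form fun k ω' hω' => ?_
      have h1 := (hσ.twisted hω' hω).symm.trans (hτ.twisted hω' hω)
      have h2 := mul_left_cancel₀ (pow_ne_zero _ (by norm_num)) h1
      change I ((σ ω - τ ω) * ω') = 0
      rw [sub_mul, map_sub, h2, sub_self]
    exact key2 ω'
  ext ω
  exact key ω

/-- The twist automorphism is `γτ`, where `∫ ω'ω = ∫ τ(ω)ω'` and `γ` is multiplication by
`(-1)^{l(N+1)}` on the `l`-forms; note that `(-1)^{kl} = (-1)^{l(N+1)}` when `k + l = N`. -/
theorem IsIntegral.exists_isTwistAutomorphism (hh : IsPositiveHaarIntegral h)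
    (hN : C.HasDimension N) (hdim : Module.finrank ℂ (C.invForm N) = 1)
    (hclosed : ∀ k, k + 1 = N → ∀ ω ∈ C.invForm k, C.d ω = 0)
    (hnondeg : C.Nondegenerate N) (hθ : C.IsVolumeElement N θ) (hI : C.IsIntegral h N θ I) :
    ∃ σ : Ω ≃ₐ[ℂ] Ω, C.IsTwistAutomorphism I σ := by
  obtain ⟨τ, hτ⟩ := hI.exists_algEquiv_isTwistPair hh hN hdim hclosed hnondeg hθ
  obtain ⟨γ, hγ⟩ := hN.exists_signEquiv
  have hId := hI.map_d hh hN hdim hclosed hθ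
  have hτmem : ∀ {k : ℕ} {ω : Ω}, ω ∈ C.form k → τ ω ∈ C.form k := fun {k ω} hω =>
    hI.twistPair_mem_form hh hN hdim hnondeg hθ (hτ ω) hω
  have hσ : ∀ {k : ℕ} {ω : Ω}, ω ∈ C.form k →
      (τ.trans γ) ω = (-1 : ℂ) ^ (k * (N + 1)) • τ ω := fun {k ω} hω => hγ k _ (hτmem hω)
  refine ⟨τ.trans γ, fun {k ω} hω => ?_, fun ω => ?_, fun {k l ω' ω} hω' hω => ?_⟩
  · rw [hσ hω]
    exact Submodule.smul_mem _ _ (hτmem hω)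
  · have key : ∀ ω₀, ((τ.trans γ).toLinearMap ∘ₗ C.d) ω₀ =
        (C.d ∘ₗ (τ.trans γ).toLinearMap) ω₀ := by
      refine C.eq_of_eqOn_form fun l ω hω => ?_
      change (τ.trans γ) (C.d ω) = C.d ((τ.trans γ) ω)
      have h1 : τ (C.d ω) = (-1 : ℂ) ^ (N + 1) • C.d (τ ω) := by
        refine sub_eq_zero.1 (hI.eq_zero_of_forall_mul_right hh hN hdim hnondeg hθ fun ω' => ?_)
        rw [sub_mul, map_sub, ← hτ, ← hI.isTwistPair_d hN hId hω (hτmem hω) (hτ ω), sub_self]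
      rw [hσ (C.d_mem hω), hσ hω, h1, map_smul, smul_smul]
      congr 1
      rw [add_mul, pow_add, one_mul, mul_assoc, ← mul_pow]
      norm_num
    exact key ω
  · rw [hσ hω, smul_mul_assoc, map_smul, smul_eq_mul, hτ ω ω']
    by_cases hkl : k + l = N
    · have : (-1 : ℂ) ^ (k * l) * (-1 : ℂ) ^ (l * (N + 1)) = 1 := by
        rw [← pow_add, ← hkl]
        refine Even.neg_one_pow ?_
        have e : k * l + l * (k + l + 1) = 2 * (k * l) + l * (l + 1) := by ring
        rw [e]
        exact (even_two_mul _).add (Nat.even_mul_succ_self l)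
      rw [← mul_assoc, this, one_mul]
    · rw [hI.eq_zero_of_ne hN (k := l + k) (by omega) (C.mul_mem (hτmem hω) hω'), mul_zero,
        mul_zero]

end StarDifferentialCalculus

/-! ### Diagonalizable operators with nonnegative eigenvalues -/

section Diagonalizable

/-- The span of the eigenvectors of `T` with nonnegative eigenvalue. -/
noncomputable def nonnegEigenspan {E : Type*} [AddCommGroup E] [Module ℂ E]
    (T : Module.End ℂ E) : Submodule ℂ E :=
  ⨆ r : NNReal, T.eigenspace ((r : ℝ) : ℂ)

variable {E : Type*} [AddCommGroup E] [Module ℂ E]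

/-- The spectral theorem for a positive operator on a finite-dimensional space. -/
theorem nonnegEigenspan_eq_top_of_nonneg [FiniteDimensional ℂ E]
    (ip : InnerProductSpace.Core ℂ E) (T : Module.End ℂ E)
    (hT : ∀ x, 0 ≤ ip.inner x (T x)) : nonnegEigenspan T = ⊤ := by
  let _ : NormedAddCommGroup E := ip.toNormedAddCommGroup
  let _ : InnerProductSpace ℂ E := InnerProductSpace.ofCore ip.toCore
  have hT' : ∀ x : E, 0 ≤ inner ℂ x (T x) := hT
  have hsymm : T.IsSymmetric := by
    rw [LinearMap.isSymmetric_iff_inner_map_self_real]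
    intro x
    rw [← inner_conj_symm, (Complex.conj_eq_iff_im).2 (Complex.nonneg_iff.1 (hT' x)).2.symm]
    exact (Complex.conj_eq_iff_im).2 (Complex.nonneg_iff.1 (hT' x)).2.symm
  have h1 := hsymm.orthogonalComplement_iSup_eigenspaces_eq_bot
  rw [Submodule.orthogonal_eq_bot_iff] at h1
  rw [eq_top_iff, ← h1]
  refine iSup_le fun μ v hv => ?_
  rw [Module.End.mem_eigenspace_iff] at hv
  by_cases hv0 : v = 0
  · rw [hv0]; exact Submodule.zero_mem _
  have h2 := hT' v
  rw [hv, inner_smul_right, inner_self_eq_norm_sq_to_K] at h2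
  have hv1 : ((‖v‖ : ℝ) : ℂ) ≠ 0 := by exact_mod_cast norm_ne_zero_iff.2 hv0
  have hv2 : (0 : ℂ) ≤ (((‖v‖ ^ 2)⁻¹ : ℝ) : ℂ) := by
    have : (0 : ℝ) ≤ (‖v‖ ^ 2)⁻¹ := by positivity
    exact_mod_cast this
  have hμ : 0 ≤ μ := by
    have h3 := mul_nonneg h2 hv2
    have e : μ * ((‖v‖ : ℝ) : ℂ) ^ 2 * (((‖v‖ ^ 2)⁻¹ : ℝ) : ℂ) = μ := by
      push_cast
      field_simp
    exact e ▸ h3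
  have hμ' := Complex.nonneg_iff.1 hμ
  refine Submodule.mem_iSup_of_mem (⟨μ.re, hμ'.1⟩ : NNReal) ?_
  rw [Module.End.mem_eigenspace_iff, hv]
  congr 1
  exact Complex.ext rfl hμ'.2.symm

/-- The eigencomponents of an element of an invariant subspace lie in this subspace: applying
`T - q` removes the component of eigenvalue `q` and rescales the others. -/
theorem eigencomponent_mem {T : Module.End ℂ E} {p : Submodule ℂ E} (hp : ∀ x ∈ p, T x ∈ p)
    (s : Finset NNReal) : ∀ x : NNReal → E,
      (∀ r ∈ s, x r ∈ T.eigenspace ((r : ℝ) : ℂ)) → ∑ r ∈ s, x r ∈ p → ∀ r ∈ s, x r ∈ p := by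
  classical
  induction s using Finset.induction_on with
  | empty => simp
  | insert q s hq ih =>
    intro x hx hsum
    have h1 : ∀ r ∈ s, (((r : ℝ) : ℂ) - ((q : ℝ) : ℂ)) • x r ∈ p := by
      refine ih (fun r => (((r : ℝ) : ℂ) - ((q : ℝ) : ℂ)) • x r)
        (fun r hr => Submodule.smul_mem _ _ (hx r (Finset.mem_insert_of_mem hr))) ?_
      have h2 := p.sub_mem (hp _ hsum) (p.smul_mem ((q : ℝ) : ℂ) hsum)
      have e : ∑ r ∈ s, (((r : ℝ) : ℂ) - ((q : ℝ) : ℂ)) • x r =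
          T (∑ r ∈ insert q s, x r) - ((q : ℝ) : ℂ) • ∑ r ∈ insert q s, x r := by
        rw [map_sum, Finset.smul_sum, ← Finset.sum_sub_distrib, Finset.sum_insert hq,
          Module.End.mem_eigenspace_iff.1 (hx q (Finset.mem_insert_self q s)), sub_self, zero_add]
        refine Finset.sum_congr rfl fun r hr => ?_
        rw [Module.End.mem_eigenspace_iff.1 (hx r (Finset.mem_insert_of_mem hr)), sub_smul]
      rwa [e]
    have h2 : ∀ r ∈ s, x r ∈ p := by
      intro r hr
      have hne : ((r : ℝ) : ℂ) - ((q : ℝ) : ℂ) ≠ 0 := by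
        intro h0
        have : r = q := by exact_mod_cast sub_eq_zero.1 h0
        exact hq (this ▸ hr)
      exact (p.smul_mem_iff hne).1 (h1 r hr)
    intro r hr
    rcases Finset.mem_insert.1 hr with rfl | hr
    · rw [Finset.sum_insert hq] at hsum
      exact (p.add_mem_iff_left (p.sum_mem h2)).1 hsum
    · exact h2 r hr

/-- An invariant subspace of a diagonalizable operator is spanned by eigenvectors. -/
theorem mem_span_eigenvectors {T : Module.End ℂ E} (hT : nonnegEigenspan T = ⊤)
    {p : Submodule ℂ E} (hp : ∀ x ∈ p, T x ∈ p) {x : E} (hx : x ∈ p) :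
    x ∈ Submodule.span ℂ {v | v ∈ p ∧ ∃ r : NNReal, T v = ((r : ℝ) : ℂ) • v} := by
  have h1 : x ∈ nonnegEigenspan T := hT ▸ trivial
  obtain ⟨f, hf, rfl⟩ := (Submodule.mem_iSup_iff_exists_finsupp _ _).1 h1
  have h2 := eigencomponent_mem hp f.support f (fun r _ => hf r) hx
  exact Submodule.sum_mem _ fun r hr => Submodule.subset_span
    ⟨h2 r hr, r, Module.End.mem_eigenspace_iff.1 (hf r)⟩

end Diagonalizable

/-! ### Invariance and diagonalizability of the twist automorphism -/

namespace StarDifferentialCalculus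

open Coalgebra HopfAlgebra

variable {A Ω : Type*} [Ring A] [StarRing A] [HopfAlgebra ℂ A] [StarModule ℂ A] [Ring Ω]
  [Algebra ℂ Ω] {C : StarDifferentialCalculus A Ω} {N : ℕ} {h : A →ₗ[ℂ] ℂ} {θ : Ω}
  {I : Ω →ₗ[ℂ] ℂ} {σ : Ω ≃ₐ[ℂ] Ω}

omit [StarModule ℂ A] in
/-- For fixed `ω ∈ Ω_l` the sign in the twist relation does not depend on the other form, since
only forms of degree `N - l` contribute. -/
theorem IsTwistAutomorphism.twisted_form (hN : C.HasDimension N) (hI : C.IsIntegral h N θ I)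
    (hσ : C.IsTwistAutomorphism I σ) {l : ℕ} {ω : Ω} (hω : ω ∈ C.form l) (y : Ω) :
    I (y * ω) = (-1 : ℂ) ^ ((N - l) * l) * I (σ ω * y) := by
  have key : ∀ ω₀, (I ∘ₗ LinearMap.mulRight ℂ ω) ω₀ =
        ((-1 : ℂ) ^ ((N - l) * l) • (I ∘ₗ LinearMap.mulLeft ℂ (σ ω))) ω₀ := by
    refine C.eq_of_eqOn_form fun k y hy => ?_
    change I (y * ω) = (-1 : ℂ) ^ ((N - l) * l) * I (σ ω * y)
    by_cases hkl : k + l = N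
    · rw [hσ.twisted hy hω]
      congr 3
      omega
    · rw [hI.eq_zero_of_ne hN hkl (C.mul_mem hy hω),
        hI.eq_zero_of_ne hN (k := l + k) (by omega) (C.mul_mem (hσ.map_mem hω) hy), mul_zero]
  exact key y

/-- The twist automorphism preserves invariance: strong left invariance of the integral shows
`S(η₁) ⊗ η₂ = 1 ⊗ η` for `η = σ(ω)`, whence `η₁ ⊗ η₂ = 1 ⊗ η`. -/
theorem IsTwistAutomorphism.map_mem_inv (hh : IsPositiveHaarIntegral h)
    (hN : C.HasDimension N) (hdim : Module.finrank ℂ (C.invForm N) = 1)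
    (hnondeg : C.Nondegenerate N) (hθ : C.IsVolumeElement N θ) (hI : C.IsIntegral h N θ I)
    (hσ : C.IsTwistAutomorphism I σ) {l : ℕ} {ω : Ω} (hω : ω ∈ C.invForm l) :
    σ ω ∈ C.inv := by
  have htw := hσ.twisted_form hN hI hω.1
  have hinv := hI.isInvariantFunctional hh hN hdim hθ
  have hs : (-1 : ℂ) ^ ((N - l) * l) ≠ 0 := pow_ne_zero _ (by norm_num)
  have h1 : ∀ y, antipode ℂ (sliceRight I (C.coact (σ ω) * ((1 : A) ⊗ₜ[ℂ] y))) =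
      I (σ ω * y) • (1 : A) := by
    intro y
    rw [← IsInvariantFunctional.strong C.isLeftCoaction hinv]
    have h2 : ∀ t : A ⊗[ℂ] Ω, (-1 : ℂ) ^ ((N - l) * l) •
        sliceRight I (((1 : A) ⊗ₜ[ℂ] σ ω) * t) = sliceRight I (t * ((1 : A) ⊗ₜ[ℂ] ω)) := by
      intro t
      induction t with
      | zero => simp
      | add u v hu hv => simp only [map_add, mul_add, add_mul, smul_add, hu, hv]
      | tmul b c => simp [htw, smul_smul]
    refine smul_right_injective A hs ?_
    change _ • _ = _ • _
    rw [h2, ← C.mem_inv.1 hω.2, ← map_mul]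
    have h3 := hinv (y * ω)
    rw [AlgHom.toLinearMap_apply] at h3
    rw [h3, htw, smul_smul]
  have h2 : (antipode ℂ).rTensor Ω (C.coact (σ ω)) = (1 : A) ⊗ₜ[ℂ] σ ω := by
    refine sub_eq_zero.1 (eq_zero_of_sliceLeft fun φ => ?_)
    refine hI.eq_zero_of_forall_mul_right hh hN hdim hnondeg hθ fun y => ?_
    have h3 : ∀ t : A ⊗[ℂ] Ω, I (sliceLeft φ ((antipode ℂ).rTensor Ω t) * y) =
        φ (antipode ℂ (sliceRight I (t * ((1 : A) ⊗ₜ[ℂ] y)))) := by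
      intro t
      induction t with
      | zero => simp
      | add u v hu hv => simp only [map_add, add_mul, hu, hv]
      | tmul b c => simp [mul_comm]
    rw [map_sub, sub_mul, map_sub, h3, h1]
    simp [mul_comm]
  have h3 := LinearMap.congr_fun (convAlong_antipode_coaction C.isLeftCoaction) (σ ω)
  refine C.mem_inv.2 (Eq.trans (Eq.symm ?_) h3)
  have h4 : ∀ t : A ⊗[ℂ] Ω, LinearMap.mul' ℂ (A ⊗[ℂ] Ω) (TensorProduct.map
      ((Algebra.TensorProduct.includeLeft : A →ₐ[ℂ] A ⊗[ℂ] Ω).toLinearMap ∘ₗ antipode ℂ)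
      C.coact.toLinearMap t) = LinearMap.mul' ℂ (A ⊗[ℂ] Ω) (TensorProduct.map
      (Algebra.TensorProduct.includeLeft : A →ₐ[ℂ] A ⊗[ℂ] Ω).toLinearMap
      C.coact.toLinearMap ((antipode ℂ).rTensor Ω t)) := by
    intro t
    induction t with
    | zero => simp
    | add u v hu hv => simp only [map_add, hu, hv]
    | tmul b c => simp
  rw [convAlong, LinearMap.comp_apply, LinearMap.comp_apply, h4, AlgHom.toLinearMap_apply, h2]
  simp [← Algebra.TensorProduct.one_def]

/-- The twist automorphism preserves finite-dimensional `*`-invariant subcoalgebras `D` of `A`: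
if `θa = a'θ`, then `σ(a)` is the image of `a'` under the modular automorphism, and
`a' = a₁ f(θa₂)` for a suitable functional `f`. -/
theorem IsTwistAutomorphism.restrict_mem (hh : IsPositiveHaarIntegral h)
    (hdim : Module.finrank ℂ (C.invForm N) = 1)
    (hθ : C.IsVolumeElement N θ) (hI : C.IsIntegral h N θ I)
    (hσ : C.IsTwistAutomorphism I σ) {D : Submodule ℂ A} [FiniteDimensional ℂ D]
    (hD : IsSliceStable D) (hstar : ∀ x ∈ D, star x ∈ D) {a : A} (ha : a ∈ D) :
    hσ.restrict a ∈ D := by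
  obtain ⟨a', ha'⟩ := exists_incl_mul_eq_mul_incl hdim hθ a
  have hmem : a' ∈ D := by
    obtain ⟨f, hf⟩ := hθ.exists_dual_ne_zero
    have h1 : a' ⊗ₜ[ℂ] θ = C.toTensor (θ * C.incl a) := by
      rw [← ha', C.toTensor_incl_mul hθ.mem.2]
    have h2 : C.coact (θ * C.incl a) =
        (LinearMap.mulLeft ℂ θ ∘ₗ C.incl.toLinearMap).lTensor A (comul (R := ℂ) a) := by
      rw [map_mul, C.coact_incl, C.mem_inv.1 hθ.mem.2]
      induction comul (R := ℂ) a with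
      | zero => simp
      | add u v hu hv => simp only [map_add, mul_add, hu, hv]
      | tmul b c => simp
    have h3 := map_mem_of_mem_tensorSpan (mem_tensorSpan_of_sliceRight (hD.right a ha))
      (sliceRight f ∘ₗ C.projInv.lTensor A ∘ₗ
        (LinearMap.mulLeft ℂ θ ∘ₗ C.incl.toLinearMap).lTensor A) (E := D)
      (fun x hx y _ => by simpa using D.smul_mem _ hx)
    rw [LinearMap.comp_apply, LinearMap.comp_apply, ← h2] at h3
    have h4 : sliceRight f (a' ⊗ₜ[ℂ] θ) ∈ D := h1 ▸ h3
    rw [sliceRight_tmul] at h4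
    exact (D.smul_mem_iff hf).1 h4
  have heq : hσ.restrict a = IsPositiveHaarIntegral.modularMap h (comul (R := ℂ) a') := by
    refine sub_eq_zero.1 (hh.eq_zero_of_forall_mul_right fun x => ?_)
    rw [sub_mul, map_sub, ← hh.mul_eq_modularMap_mul]
    have h1 := hσ.twisted (C.incl_mul_mem x hθ.mem.1) (C.incl_mem a)
    rw [mul_zero, pow_zero, one_mul, mul_assoc, ← ha', ← hσ.incl_restrict, ← mul_assoc,
      ← mul_assoc, ← map_mul, ← map_mul, hI.top, hI.top] at h1
    rw [h1, sub_self]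
  rw [heq]
  exact hh.modularMap_comul_mem hD hstar hmem

/-- If `h(a* σ(a)) ≥ 0` for all `a`, then `σ` is diagonalizable on `A` with nonnegative
eigenvalues, being positive on each finite-dimensional `*`-invariant subcoalgebra. -/
theorem IsTwistAutomorphism.nonnegEigenspan_restrict [IsHopfStarAlgebra A]
    (hh : IsPositiveHaarIntegral h)
    (hdim : Module.finrank ℂ (C.invForm N) = 1)
    (hθ : C.IsVolumeElement N θ) (hI : C.IsIntegral h N θ I)
    (hσ : C.IsTwistAutomorphism I σ) (hpos : ∀ a : A, 0 ≤ h (star a * hσ.restrict a)) :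
    nonnegEigenspan (hσ.restrict.toLinearMap : Module.End ℂ A) = ⊤ := by
  rw [eq_top_iff]
  intro a _
  obtain ⟨D, haD, _, hD, hstar⟩ := exists_finiteDimensional_sliceStable a
  let ip : InnerProductSpace.Core ℂ D :=
    { inner := fun x y => h (star (x : A) * y)
      conj_inner_symm := fun x y => by rw [← hh.map_star]; simp
      re_inner_nonneg := fun x => (Complex.nonneg_iff.1 (hh.nonneg x)).1
      add_left := fun x y z => by simp [add_mul]
      smul_left := fun x y c => by simp
      definite := fun x hx => Subtype.ext (hh.eq_zero_of_star_mul_self hx) }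
  have hmaps : ∀ x ∈ D, hσ.restrict.toLinearMap x ∈ D := fun x hx =>
    hσ.restrict_mem hh hdim hθ hI hD hstar hx
  have htop := nonnegEigenspan_eq_top_of_nonneg ip
    (LinearMap.restrict hσ.restrict.toLinearMap hmaps) (fun x => hpos x)
  have hle : nonnegEigenspan (LinearMap.restrict hσ.restrict.toLinearMap hmaps) ≤
      (nonnegEigenspan (hσ.restrict.toLinearMap : Module.End ℂ A)).comap D.subtype := by
    refine iSup_le fun r x hx => ?_
    rw [Module.End.mem_eigenspace_iff] at hx
    refine Submodule.mem_iSup_of_mem r ?_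
    rw [Module.End.mem_eigenspace_iff]
    exact congrArg Subtype.val hx
  have hmem : (⟨a, haD⟩ : D) ∈
      nonnegEigenspan (LinearMap.restrict hσ.restrict.toLinearMap hmaps) := htop ▸ trivial
  exact hle hmem

omit [StarModule ℂ A] in
/-- The products of eigenvectors of an automorphism are eigenvectors, and the forms are generated
by `A` and `dA`. -/
theorem IsTwistAutomorphism.nonnegEigenspan_eq_top (hσ : C.IsTwistAutomorphism I σ)
    (hA : nonnegEigenspan (hσ.restrict.toLinearMap : Module.End ℂ A) = ⊤) :
    nonnegEigenspan (σ.toLinearMap : Module.End ℂ Ω) = ⊤ := by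
  let P : Subalgebra ℂ Ω := (nonnegEigenspan (σ.toLinearMap : Module.End ℂ Ω)).toSubalgebra
    (Submodule.mem_iSup_of_mem 1 (by simp))
    (fun x y hx hy => by
      have hmul : nonnegEigenspan (σ.toLinearMap : Module.End ℂ Ω) *
          nonnegEigenspan (σ.toLinearMap : Module.End ℂ Ω) ≤
          nonnegEigenspan (σ.toLinearMap : Module.End ℂ Ω) := by
        conv_lhs => rw [nonnegEigenspan, Submodule.iSup_mul]
        refine iSup_le fun r => ?_
        rw [Submodule.mul_iSup]
        refine iSup_le fun q => Submodule.mul_le.2 fun x hx y hy => ?_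
        rw [Module.End.mem_eigenspace_iff, AlgEquiv.toLinearMap_apply] at hx hy
        refine Submodule.mem_iSup_of_mem (r * q) ?_
        rw [Module.End.mem_eigenspace_iff, AlgEquiv.toLinearMap_apply, map_mul, hx, hy,
          smul_mul_smul_comm]
        simp
      exact hmul (Submodule.mul_mem_mul hx hy))
  have hle : ∀ f : A →ₗ[ℂ] Ω, (∀ a, σ (f a) = f (hσ.restrict a)) → ∀ a, f a ∈ P := by
    intro f hf a
    have hle : nonnegEigenspan (hσ.restrict.toLinearMap : Module.End ℂ A) ≤
        (nonnegEigenspan (σ.toLinearMap : Module.End ℂ Ω)).comap f := by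
      refine iSup_le fun r x hx => ?_
      rw [Module.End.mem_eigenspace_iff, AlgHom.toLinearMap_apply] at hx
      refine Submodule.mem_iSup_of_mem r ?_
      rw [Module.End.mem_eigenspace_iff, AlgEquiv.toLinearMap_apply, hf, hx, map_smul]
    exact hle (hA ▸ trivial)
  have hP : P = ⊤ := C.subalgebra_eq_top
    (hle C.incl.toLinearMap fun a => (hσ.incl_restrict a).symm)
    (hle (C.d ∘ₗ C.incl.toLinearMap) fun a => by
      change σ (C.d (C.incl a)) = C.d (C.incl (hσ.restrict a))
      rw [hσ.map_d, hσ.incl_restrict])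
  rw [eq_top_iff]
  intro x _
  have : x ∈ P := hP ▸ trivial
  exact this

end StarDifferentialCalculus

/-! ### The inner product defined by a basis of invariant forms -/

theorem exists_dual_of_linearIndependent {ι E : Type*} [DecidableEq ι] [AddCommGroup E]
    [Module ℂ E] {v : ι → E} (hv : LinearIndependent ℂ v) :
    ∃ f : ι → E →ₗ[ℂ] ℂ, ∀ i j, f i (v j) = if i = j then 1 else 0 := by
  have h (i : ι) := LinearMap.exists_extend (Finsupp.lapply i ∘ₗ hv.repr)
  choose f hf using h
  refine ⟨f, fun i j => ?_⟩
  have h1 := LinearMap.congr_fun (hf i) ⟨v j, Submodule.subset_span ⟨j, rfl⟩⟩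
  have h2 : hv.repr ⟨v j, Submodule.subset_span ⟨j, rfl⟩⟩ = Finsupp.single j 1 :=
    hv.repr_eq_single j _ rfl
  simp only [LinearMap.comp_apply, Submodule.subtype_apply, h2,
    Finsupp.lapply_apply, Finsupp.single_apply] at h1
  rw [h1]
  simp only [eq_comm]

namespace StarDifferentialCalculus

open Coalgebra HopfAlgebra

variable {A Ω : Type*} [Ring A] [StarRing A] [HopfAlgebra ℂ A] [Ring Ω] [Algebra ℂ Ω]
  {C : StarDifferentialCalculus A Ω}

section Coordinates

variable {ι : Type*} [Fintype ι] [DecidableEq ι] {v : ι → Ω} {f : ι → Ω →ₗ[ℂ] ℂ}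

variable (C) in
/-- The coordinate map `Ω → A` attached to a functional `f`, with `av ↦ f(v) a` for invariant
`v`. -/
noncomputable def coordForm (f : Ω →ₗ[ℂ] ℂ) : Ω →ₗ[ℂ] A := sliceRight f ∘ₗ C.toTensor

omit [Fintype ι] [DecidableEq ι] in
theorem coordForm_incl_mul (f : Ω →ₗ[ℂ] ℂ) {w : Ω} (hw : w ∈ C.inv) (a : A) :
    C.coordForm f (C.incl a * w) = f w • a := by
  rw [coordForm, LinearMap.comp_apply, C.toTensor_incl_mul hw, sliceRight_tmul]

theorem sum_coordForm (hspan : Submodule.span ℂ (Set.range v) = C.inv)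
    (hf : ∀ i j, f i (v j) = if i = j then 1 else 0) (ω : Ω) :
    ∑ i, C.incl (C.coordForm (f i) ω) * v i = ω := by
  have hv : ∀ i, v i ∈ C.inv := fun i => hspan ▸ Submodule.subset_span ⟨i, rfl⟩
  let G : Ω →ₗ[ℂ] Ω := ∑ i, LinearMap.mulRight ℂ (v i) ∘ₗ C.incl.toLinearMap ∘ₗ C.coordForm (f i)
  have hG : ∀ ω, G ω = ∑ i, C.incl (C.coordForm (f i) ω) * v i := fun ω => by
    simp [G, LinearMap.sum_apply]
  have h1 : ∀ a, ∀ w ∈ C.inv, G (C.incl a * w) = C.incl a * w := by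
    intro a w hw
    have hle : C.inv ≤ LinearMap.eqLocus (G ∘ₗ LinearMap.mulLeft ℂ (C.incl a))
        (LinearMap.mulLeft ℂ (C.incl a)) := by
      rw [← hspan, Submodule.span_le]
      rintro _ ⟨j, rfl⟩
      change G (C.incl a * v j) = C.incl a * v j
      rw [hG, Finset.sum_eq_single j]
      · rw [coordForm_incl_mul _ (hv j), hf, if_pos rfl, one_smul]
      · intro i _ hi
        rw [coordForm_incl_mul _ (hv j), hf, if_neg hi, zero_smul, map_zero, zero_mul]
      · intro hj
        exact absurd (Finset.mem_univ j) hj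
    exact hle hw
  have key : ∀ ω₀, G ω₀ = (LinearMap.id : Ω →ₗ[ℂ] Ω) ω₀ := C.eq_of_eqOn_form fun k ω hω =>
    C.mem_of_incl_mul_invForm_mem (P := LinearMap.eqLocus G LinearMap.id)
      (fun a w hw => h1 a w hw.2) hω
  rw [← hG]
  exact key ω

theorem coordForm_sum (hspan : Submodule.span ℂ (Set.range v) = C.inv)
    (hf : ∀ i j, f i (v j) = if i = j then 1 else 0) (c : ι → A) (i : ι) :
    C.coordForm (f i) (∑ j, C.incl (c j) * v j) = c i := by
  have hv : ∀ i, v i ∈ C.inv := fun i => hspan ▸ Submodule.subset_span ⟨i, rfl⟩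
  rw [map_sum, Finset.sum_eq_single i]
  · rw [coordForm_incl_mul _ (hv i), hf, if_pos rfl, one_smul]
  · intro j _ hj
    rw [coordForm_incl_mul _ (hv j), hf, if_neg hj.symm, zero_smul]
  · intro hi
    exact absurd (Finset.mem_univ i) hi

/-- For homogeneous `vᵢ` the expansion `ω = ∑ aᵢvᵢ` of a `k`-form involves only `vᵢ ∈ Ω_k`. -/
theorem coordForm_eq_zero (hspan : Submodule.span ℂ (Set.range v) = C.inv)
    (hf : ∀ i j, f i (v j) = if i = j then 1 else 0) {i : ι} {j k : ℕ} (hj : v i ∈ C.form j)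
    (hdeg : ∀ i, ∃ k, v i ∈ C.form k) (hjk : j ≠ k) {ω : Ω} (hω : ω ∈ C.form k) :
    C.coordForm (f i) ω = 0 := by
  choose deg hdeg using hdeg
  have h1 : ω = ∑ l, C.incl (if deg l = k then C.coordForm (f l) ω else 0) * v l := by
    conv_lhs => rw [← C.formProj_of_mem hω, ← sum_coordForm hspan hf ω]
    rw [map_sum]
    refine Finset.sum_congr rfl fun l _ => ?_
    split_ifs with hl
    · exact C.formProj_of_mem (C.incl_mul_mem _ (hl ▸ hdeg l))
    · rw [C.formProj_of_mem_ne hl (C.incl_mul_mem _ (hdeg l)), map_zero, zero_mul]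
  rw [h1, coordForm_sum hspan hf]
  split_ifs with hi
  · have h0 : v i = 0 := by
      rw [← C.formProj_of_mem (hdeg i), C.formProj_of_mem_ne (hi ▸ hjk) hj]
    have h2 := hf i i
    rw [h0, map_zero, if_pos rfl] at h2
    exact absurd h2 zero_ne_one
  · rfl

variable [StarModule ℂ A] {h : A →ₗ[ℂ] ℂ}

/-- The left-invariant inner product for which the basis `v` of the invariant forms is
orthonormal: `⟨∑ aᵢvᵢ, ∑ bᵢvᵢ⟩ = ∑ h(aᵢ* bᵢ)`. -/
noncomputable abbrev coordCore (hh : IsPositiveHaarIntegral h)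
    (hspan : Submodule.span ℂ (Set.range v) = C.inv)
    (hf : ∀ i j, f i (v j) = if i = j then 1 else 0) : InnerProductSpace.Core ℂ Ω where
  inner ω η := ∑ i, h (star (C.coordForm (f i) ω) * C.coordForm (f i) η)
  conj_inner_symm ω η := by
    rw [map_sum]
    refine Finset.sum_congr rfl fun i _ => ?_
    rw [← hh.map_star]
    simp
  re_inner_nonneg ω := by
    have h1 : 0 ≤ ∑ i, h (star (C.coordForm (f i) ω) * C.coordForm (f i) ω) :=
      Finset.sum_nonneg fun i _ => hh.nonneg _
    exact (Complex.nonneg_iff.1 h1).1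
  add_left ω η ζ := by
    simp [add_mul, Finset.sum_add_distrib]
  smul_left ω η c := by
    simp [Finset.mul_sum]
  definite ω hω := by
    have h1 := (Finset.sum_eq_zero_iff_of_nonneg
      (fun i _ => hh.nonneg (C.coordForm (f i) ω))).1 hω
    rw [← sum_coordForm hspan hf ω]
    refine Finset.sum_eq_zero fun i hi => ?_
    rw [hh.eq_zero_of_star_mul_self (h1 i hi), map_zero, zero_mul]

end Coordinates

variable [StarModule ℂ A] {N : ℕ} {h : A →ₗ[ℂ] ℂ} {θ : Ω} {I : Ω →ₗ[ℂ] ℂ} {σ : Ω ≃ₐ[ℂ] Ω}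

/-- The invariant forms have a basis of homogeneous eigenvectors of the twist automorphism. -/
theorem IsTwistAutomorphism.exists_eigenbasis (hh : IsPositiveHaarIntegral h)
    (hfin : C.StronglyFiniteDimensional)
    (hN : C.HasDimension N) (hdim : Module.finrank ℂ (C.invForm N) = 1)
    (hnondeg : C.Nondegenerate N) (hθ : C.IsVolumeElement N θ) (hI : C.IsIntegral h N θ I)
    (hσ : C.IsTwistAutomorphism I σ)
    (htop : nonnegEigenspan (σ.toLinearMap : Module.End ℂ Ω) = ⊤) :
    ∃ b : Set Ω, b.Finite ∧ LinearIndependent ℂ ((↑) : b → Ω) ∧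
      Submodule.span ℂ b = C.inv ∧
      ∀ w ∈ b, (∃ k, w ∈ C.form k) ∧ ∃ r : NNReal, σ w = ((r : ℝ) : ℂ) • w := by
  let s : Set Ω := {w | w ∈ C.inv ∧ (∃ k, w ∈ C.form k) ∧ ∃ r : NNReal, σ w = ((r : ℝ) : ℂ) • w}
  obtain ⟨b, hbs, hspan, hli⟩ := exists_linearIndependent ℂ s
  have hs : Submodule.span ℂ s = C.inv := by
    refine le_antisymm (Submodule.span_le.2 fun w hw => hw.1)
      (C.inv_le_of_invForm_le fun k w hw => ?_)
    have h1 := mem_span_eigenvectors htop (p := C.invForm k)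
      (fun x hx => ⟨hσ.map_mem hx.1, hσ.map_mem_inv hh hN hdim hnondeg hθ hI hx⟩) hw
    refine Submodule.span_mono ?_ h1
    rintro x ⟨hx, hr⟩
    exact ⟨hx.2, ⟨k, hx.1⟩, hr⟩
  refine ⟨b, ?_, hli, hspan.trans hs, fun w hw => (hbs hw).2⟩
  have : FiniteDimensional ℂ C.inv := hfin
  have hli' : LinearIndependent ℂ (fun w : b => (⟨w, (hbs w.2).1⟩ : C.inv)) :=
    LinearIndependent.of_comp C.inv.subtype hli
  have : Finite b := hli'.finite
  exact Set.toFinite b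

/-- For `σ` positive on `A`, the inner product that makes a basis of homogeneous eigenvectors of
`σ` in the invariant forms orthonormal makes `σ` positive. -/
theorem IsTwistAutomorphism.exists_inner [IsHopfStarAlgebra A] (hh : IsPositiveHaarIntegral h)
    (hfin : C.StronglyFiniteDimensional)
    (hN : C.HasDimension N) (hdim : Module.finrank ℂ (C.invForm N) = 1)
    (hnondeg : C.Nondegenerate N) (hθ : C.IsVolumeElement N θ) (hI : C.IsIntegral h N θ I)
    (hσ : C.IsTwistAutomorphism I σ) (hpos : ∀ a : A, 0 ≤ h (star a * hσ.restrict a)) :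
    ∃ ip : InnerProductSpace.Core ℂ Ω, C.IsGradedInner ip ∧ C.IsLeftInvariantInner h ip ∧
      ∀ ω : Ω, 0 ≤ ip.inner ω (σ ω) := by
  classical
  have htop := hσ.nonnegEigenspan_eq_top (hσ.nonnegEigenspan_restrict hh hdim hθ hI hpos)
  obtain ⟨b, hbfin, hli, hspan, hb⟩ :=
    hσ.exists_eigenbasis hh hfin hN hdim hnondeg hθ hI htop
  have : Fintype b := hbfin.fintype
  obtain ⟨f, hf⟩ := exists_dual_of_linearIndependent hli
  have hspan' : Submodule.span ℂ (Set.range ((↑) : b → Ω)) = C.inv := by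
    rw [Subtype.range_coe, hspan]
  refine ⟨coordCore hh hspan' hf, ?_, ?_, ?_⟩
  · intro j k hjk ω hω η hη
    refine Finset.sum_eq_zero fun i _ => ?_
    obtain ⟨l, hl⟩ := (hb i i.2).1
    have hdeg : ∀ i : b, ∃ k, (i : Ω) ∈ C.form k := fun i => (hb i i.2).1
    by_cases hlj : l = j
    · rw [coordForm_eq_zero hspan' hf hl hdeg (hlj.trans_ne hjk) hη, mul_zero, map_zero]
    · rw [coordForm_eq_zero hspan' hf hl hdeg hlj hω, star_zero, zero_mul, map_zero]
  · intro a c ω hω η hη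
    have e : ∀ i : b, ∀ ω ∈ C.inv, C.coordForm (f i) ω = f i ω • (1 : A) := fun i ω hω => by
      have h1 := coordForm_incl_mul (f i) hω 1
      rwa [map_one, one_mul] at h1
    change ∑ i, _ = _ * ∑ i, _
    rw [Finset.mul_sum]
    refine Finset.sum_congr rfl fun i _ => ?_
    rw [coordForm_incl_mul _ hω, coordForm_incl_mul _ hη, e i ω hω, e i η hη]
    simp [hh.map_one]
    ring
  · intro ω
    refine Finset.sum_nonneg fun i _ => ?_
    choose r hr using fun i : b => (hb i i.2).2
    have e : σ ω = ∑ j : b, C.incl (((r j : ℝ) : ℂ) • hσ.restrict (C.coordForm (f j) ω)) * j := by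
      conv_lhs => rw [← sum_coordForm hspan' hf ω]
      rw [map_sum]
      refine Finset.sum_congr rfl fun j _ => ?_
      rw [map_mul, hr, ← hσ.incl_restrict, map_smul, mul_smul_comm, smul_mul_assoc]
    rw [e, coordForm_sum hspan' hf, mul_smul_comm, map_smul, smul_eq_mul]
    refine mul_nonneg ?_ (hpos _)
    exact_mod_cast (r i).2

omit [StarModule ℂ A] in
/-- On `A` a left-invariant inner product is `h(b* a)` up to the positive factor `⟨1, 1⟩`. -/
theorem IsTwistAutomorphism.nonneg_of_inner (hθ : C.IsVolumeElement N θ)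
    (hσ : C.IsTwistAutomorphism I σ) {ip : InnerProductSpace.Core ℂ Ω}
    (hinv : C.IsLeftInvariantInner h ip) (hpos : ∀ ω : Ω, 0 ≤ ip.inner ω (σ ω)) (a : A) :
    0 ≤ h (star a * hσ.restrict a) := by
  have h1 := hpos (C.incl a)
  have hone : (1 : Ω) ∈ C.inv := by
    rw [C.mem_inv, map_one, Algebra.TensorProduct.one_def]
  have e := hinv (hσ.restrict a) a 1 hone 1 hone
  rw [mul_one, mul_one] at e
  rw [← hσ.incl_restrict, e] at h1
  have hne : ip.inner 1 1 ≠ 0 := fun h0 => by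
    have h2 : (1 : Ω) = 0 := ip.definite 1 h0
    exact hθ.ne_zero (by rw [← one_mul θ, h2, zero_mul])
  have h3 : 0 ≤ ip.inner 1 1 := by
    refine Complex.nonneg_iff.2 ⟨ip.re_inner_nonneg 1, ?_⟩
    exact ((Complex.conj_eq_iff_im).1 (ip.conj_inner_symm 1 1)).symm
  have h4 : 0 ≤ (ip.inner 1 1)⁻¹ := by
    rw [Complex.nonneg_iff] at h3 ⊢
    rw [Complex.inv_re, Complex.inv_im, ← h3.2]
    exact ⟨div_nonneg h3.1 (Complex.normSq_nonneg _), by simp⟩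
  have h5 := mul_nonneg h1 h4
  rwa [mul_assoc, mul_inv_cancel₀ hne, mul_one] at h5

end StarDifferentialCalculus

theorem mainTheorem6 {A Ω : Type*} [Ring A] [StarRing A] [HopfAlgebra ℂ A] [StarModule ℂ A]
    [IsHopfStarAlgebra A] [Ring Ω] [Algebra ℂ Ω]
    (C : StarDifferentialCalculus A Ω)
    (h : A →ₗ[ℂ] ℂ) (hh : IsPositiveHaarIntegral h)
    (hfin : C.StronglyFiniteDimensional)
    (N : ℕ) (hN : C.HasDimension N)
    (hdim : Module.finrank ℂ (C.invForm N) = 1)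
    (hclosed : ∀ k, k + 1 = N → ∀ ω ∈ C.invForm k, C.d ω = 0)
    (hnondeg : C.Nondegenerate N)
    (θ : Ω) (hθ : C.IsVolumeElement N θ) :
    (∃! I : Ω →ₗ[ℂ] ℂ, C.IsIntegral h N θ I) ∧
    ∀ I : Ω →ₗ[ℂ] ℂ, C.IsIntegral h N θ I →
      (∃! σ : Ω ≃ₐ[ℂ] Ω, C.IsTwistAutomorphism I σ) ∧
      ∀ (σ : Ω ≃ₐ[ℂ] Ω) (hσ : C.IsTwistAutomorphism I σ),
        ((∃ ip : InnerProductSpace.Core ℂ Ω, C.IsGradedInner ip ∧ C.IsLeftInvariantInner h ip ∧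
            ∀ ω : Ω, 0 ≤ ip.inner ω (σ ω)) ↔
          ∀ a : A, 0 ≤ h (star a * hσ.restrict a)) := by
  refine ⟨?_, fun I hI => ⟨?_, fun σ hσ => ⟨?_, ?_⟩⟩⟩
  · obtain ⟨I, hI⟩ := StarDifferentialCalculus.exists_isIntegral h hθ
    exact ⟨I, hI, fun J hJ => hJ.unique hN hdim hθ hI⟩
  · obtain ⟨σ, hσ⟩ := hI.exists_isTwistAutomorphism hh hN hdim hclosed hnondeg hθ
    exact ⟨σ, hσ, fun τ hτ => hτ.unique hh hN hdim hnondeg hθ hI hσ⟩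
  · rintro ⟨ip, -, hinv, hpos⟩
    exact hσ.nonneg_of_inner hθ hinv hpos
  · exact hσ.exists_inner hh hfin hN hdim hnondeg hθ hI
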